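/- An instance of the metric facility location problem consists of finite sets $C$ (cities) and $F$ (facilities), connection costs $c_{ij}\ge 0$ and opening costs $f_i\ge 0$ ($i\in F$, $j\in C$) such that $c_{ij}\le c_{ij'}+c_{i'j'}+c_{i'j}$ for all $i,i'\in F$ and $j,j'\in C$. A solution opens a set $F'\subseteq F$ and connects each city to a facility of $F'$; its cost is the sum of the opening costs and of the connection costs, and $\mathrm{OPT}$ is the minimum cost. Algorithm A1 starts with all facilities unopened, all cities unconnected and all budgets $\alpha_j=0$. Let $U$ be the current set of unconnected cities. While $U\neq\emptyset$, the budgets of all unconnected cities are increased continuously at the same rate until one of the following events occurs (simultaneous events are processed one at a time in an arbitrary order). (a) $\alpha_j=c_{ij}$ for some unconnected city $j$ and some open facility $i$: then $j$ is connected to $i$. (b) $\sum_{j\in U}\max(\alpha_j-c_{ij},0)=f_i$ for some unopened facility $i$: then $i$ is opened, and every unconnected city $j$ with $\alpha_j\ge c_{ij}$ is connected to $i$. The solution produced consists of the opened facilities and the connections made. The approximation factor of A1 is the least $\rho$ such that, on every metric instance, every execution of A1 produces a solution of cost at most $\rho\cdot\mathrm{OPT}$. For $k\ge 1$ let $u_k$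 be the optimal value of the linear program $$\max\ \sum_{j=1}^k\alpha_j$$ subject to $f+\sum_{j=1}^k d_j\le 1$; $\alpha_j\le\alpha_{j+1}$ for $1\le j<k$; $\alpha_j\le\alpha_l+d_j+d_l$ for $1\le j,l\le k$; $x_{jl}\ge\alpha_j-d_l$ for $1\le j<l\le k$; $\sum_{l=j}^k x_{jl}\le f$ for $1\le j\le k$; and $\alpha_j,d_j,f,x_{jl}\ge 0$ for $1\le j\le l\le k$ (the upper bound factor-revealing program). Let $z_k$ be the optimal value of the same program with the additional constraints $x_{jj}\ge\alpha_j-d_j$ for $1\le j\le k$ (the lower bound factor-revealing program). **Lemma.** The approximation factor $\rho$ of A1 for the metric facility location problem exists and lies between $1.814$ and $1.816$. More precisely, the programs for $k=1000$ have optimal values $z_{1000}$ and $u_{1000}$, and $$1.814 < z_{1000}\le\rho\le u_{1000}<1.816 .$$ -/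

import Mathlib

open scoped BigOperators

/-- An instance of the (uncapacitated) facility location problem with finite set of cities `C`
and finite set of facilities `F`: `c i j` is the cost of connecting facility `i` to city `j`
and `f i` is the cost of opening facility `i`. -/
structure FLInstance (C F : Type) where
  c : F → C → ℝ
  f : F → ℝ
  c_nonneg : ∀ i j, 0 ≤ c i j
  f_nonneg : ∀ i, 0 ≤ f i

namespace FLInstance

variable {C F : Type}

/-- The triangle inequality for facility location instances. -/
def IsMetric (I : FLInstance C F) : Prop :=
  ∀ (i i' : F) (j j' : C), I.c i j ≤ I.c i j' + I.c i' j' + I.c i' j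

/-- A feasible solution: a set of facilities to open and, for every city, an open facility to
which it is connected. -/
structure Solution (C F : Type) where
  opened : Finset F
  assign : C → F
  assign_mem : ∀ j, assign j ∈ opened

/-- The cost of a feasible solution: opening costs plus connection costs. -/
noncomputable def solutionCost [Fintype C] (I : FLInstance C F) (S : Solution C F) : ℝ :=
  ∑ i ∈ S.opened, I.f i + ∑ j, I.c (S.assign j) j

/-- A state of the algorithm: the budgets of the cities, the set of open facilities, and the
facility to which each city is connected (`none` for an unconnected city). -/
structure State (C F : Type) where
  budget : C → ℝ
  opened : Finset F
  conn : C → Option F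

namespace State

/-- Initially all budgets are zero, every facility is unopened and every city is unconnected. -/
def init : State C F where
  budget := fun _ => 0
  opened := ∅
  conn := fun _ => none

/-- The set `U` of unconnected cities. -/
def unconnected [Fintype C] (s : State C F) : Finset C :=
  Finset.univ.filter fun j => (s.conn j).isNone

/-- Increase the budgets of all unconnected cities simultaneously by `δ`. -/
def advance (s : State C F) (δ : ℝ) : State C F where
  budget := fun j => if (s.conn j).isNone then s.budget j + δ else s.budget j
  opened := s.opened
  conn := s.conn

end State

variable [Fintype C]

/-- Event (a): the budget of the unconnected city `j` equals its connection cost to the open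
facility `i`. -/
def ConnectEvent (I : FLInstance C F) (s : State C F) (j : C) (i : F) : Prop :=
  j ∈ s.unconnected ∧ i ∈ s.opened ∧ s.budget j = I.c i j

/-- Event (b): the total budget offered by the unconnected cities to the unopened facility `i`
equals its opening cost. -/
def OpenEvent (I : FLInstance C F) (s : State C F) (i : F) : Prop :=
  i ∉ s.opened ∧ ∑ j ∈ s.unconnected, max (s.budget j - I.c i j) 0 = I.f i

/-- Some event occurs in the state `s`. -/
def HasEvent (I : FLInstance C F) (s : State C F) : Prop :=
  (∃ j i, I.ConnectEvent s j i) ∨ ∃ i, I.OpenEvent s i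

/-- The state `t` arises from `s` by raising the budgets of the unconnected cities until the
first moment at which an event occurs. -/
def RaiseUntilEvent (I : FLInstance C F) (s t : State C F) : Prop :=
  ∃ δ : ℝ, 0 ≤ δ ∧ (∀ δ' : ℝ, 0 ≤ δ' → δ' < δ → ¬ I.HasEvent (s.advance δ')) ∧
    t = s.advance δ ∧ I.HasEvent t

open Classical in
/-- Connect the city `j` to the open facility `i`. -/
noncomputable def connectCity (s : State C F) (j : C) (i : F) : State C F where
  budget := s.budget
  opened := s.opened
  conn := Function.update s.conn j (some i)

open Classical in
/-- Open the facility `i` and connect to it every unconnected city whose budget is at least its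
connection cost to `i`. -/
noncomputable def openFacility (I : FLInstance C F) (s : State C F) (i : F) : State C F where
  budget := s.budget
  opened := insert i s.opened
  conn := fun j => if j ∈ s.unconnected ∧ I.c i j ≤ s.budget j then some i else s.conn j

/-- One iteration of the main loop of the algorithm: while some city is unconnected, raise the
budgets until some event occurs, and process one event occurring at that moment. -/
inductive Step (I : FLInstance C F) : State C F → State C F → Prop
  | connect {s t : State C F} {j : C} {i : F} (hU : s.unconnected.Nonempty)
      (h : I.RaiseUntilEvent s t) (hev : I.ConnectEvent t j i) : Step I s (connectCity t j i)
  | openFac {s t : State C F} {i : F} (hU : s.unconnected.Nonempty)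
      (h : I.RaiseUntilEvent s t) (hev : I.OpenEvent t i) : Step I s (I.openFacility t i)

/-- `s` is a final state of some complete execution of the algorithm on the instance `I` (ties
between simultaneous events may be broken arbitrarily). -/
def IsOutput (I : FLInstance C F) (s : State C F) : Prop :=
  Relation.ReflTransGen I.Step State.init s ∧ s.unconnected = ∅

/-- The cost of the solution described by a state: opening costs of the open facilities plus
connection costs of the connected cities. -/
noncomputable def stateCost (I : FLInstance C F) (s : State C F) : ℝ :=
  ∑ i ∈ s.opened, I.f i + ∑ j, (s.conn j).elim 0 fun i => I.c i j

end FLInstance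

/-- The algorithm A1 is a `γ`-approximation for the metric facility location problem: on every
metric instance, the cost of the solution produced by any execution is at most `γ` times the cost
of every feasible solution, that is, at most `γ` times the optimal cost. -/
def IsA1MetricApprox (γ : ℝ) : Prop :=
  ∀ (C F : Type) [Fintype C] [Fintype F] (I : FLInstance C F), I.IsMetric →
    ∀ s : FLInstance.State C F, I.IsOutput s →
      ∀ S : FLInstance.Solution C F, I.stateCost s ≤ γ * I.solutionCost S

/-- The approximation factor of A1 for the metric facility location problem is `ρ`: it is the
least `γ` such that A1 is a `γ`-approximation. -/
def IsA1MetricFactor (ρ : ℝ) : Prop := IsLeast {γ : ℝ | IsA1MetricApprox γ} ρ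

/-- The constraints shared by the lower bound and the upper bound factor-revealing linear programs
of A1 in the metric case (cities are indexed by `Fin k`; only the variables `x j l` with `j ≤ l`
occur). -/
structure CommonConstraints (k : ℕ) (α d : Fin k → ℝ) (x : Fin k → Fin k → ℝ) (f : ℝ) : Prop where
  budget : f + ∑ j, d j ≤ 1
  mono : ∀ j l : Fin k, (j : ℕ) + 1 = l → α j ≤ α l
  metric : ∀ j l, α j ≤ α l + d j + d l
  contribution : ∀ j, ∑ l ∈ Finset.Ici j, x j l ≤ f
  α_nonneg : ∀ j, 0 ≤ α j
  d_nonneg : ∀ j, 0 ≤ d j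
  f_nonneg : 0 ≤ f
  x_nonneg : ∀ j l, j ≤ l → 0 ≤ x j l

/-- Objective values of the feasible solutions of the lower bound factor-revealing program. -/
def lowerValues (k : ℕ) : Set ℝ :=
  {v | ∃ α d x f, CommonConstraints k α d x f ∧ (∀ j l, j ≤ l → α j - d l ≤ x j l) ∧
    v = ∑ j, α j}

/-- Objective values of the feasible solutions of the upper bound factor-revealing program: the
constraints `α j - d j ≤ x j j` are dropped. -/
def upperValues (k : ℕ) : Set ℝ :=
  {v | ∃ α d x f, CommonConstraints k α d x f ∧ (∀ j l, j < l → α j - d l ≤ x j l) ∧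
    v = ∑ j, α j}

/-!
The argument is dual fitting with a factor-revealing linear program, and its converse.

*Upper bound.*  The cost of an output of the algorithm is the sum of the final budgets
(`FLInstance.IsOutput.stateCost_eq`).  Fix a facility `i` and a set of cities.  If `j` is connected
after `l`, then the facility of `l` is open while `j` waits, so the triangle inequality gives
`α j ≤ α l + c i j + c i l`; and at the time `α j` the cities still waiting offer at most `f i` in
total, since otherwise `i` would have been opened before.  Both facts follow from an invariant of
the execution (`FLInstance.Invariant`).  Sorted by budget, the cities therefore satisfy the
constraints of a factor-revealing program of *their own* size `m`.  Repeating every city `k` times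
and merging the `k * m` copies into `k` groups of `m` gives a feasible solution of the upper
program of size `k` (`sum_range_le_mul_of_mem_upperBounds`), so its value bounds the ratio of every
star, and summing over the stars of a solution bounds the cost of the output.

*Lower bound.*  A feasible solution of the lower program is turned into a tree metric
(`spiderInstance`): a facility of cost `f` in the centre, at distance `d j` from the city `j`, and a
free facility at distance `α j` beyond each city.  The contribution constraints say that the central
facility never has to be opened before the cities reach their free facilities, so some execution
pays `∑ α j`, while opening the centre costs `f + ∑ d j ≤ 1`.

*Numerical values.*  The metric constraints `α j - d j ≤ α l + d l` say that some `s` satisfies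
`|α j - s| ≤ d j` for all `j`.  Hence in weak duality the metric constraints need no multipliers of
their own: weights for the contribution constraints suffice, and what they miss in the coefficient
of `α j` is paid by `d j` (`sum_range_le_mul_of_dual`).  A dual solution given by an
explicit piecewise formula (`dualCumulative`) proves `u < 1.816`.  Conversely, a primal solution is
determined by `s` and the budgets, with `d j = |α j - s|`; the list `thousandBudgets` proves
`1.814 < z`.  Both certificates consist of natural numbers and are evaluated in the kernel.
-/

/-! ### The programs without contribution variables, and their maxima -/

/-- The factor-revealing programs with the variables `x` eliminated: `r j` is the set of cities
whose offer at time `α j` is charged against the opening cost `f`. -/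
structure StarProgram (k : ℕ) (r : Fin k → Finset (Fin k)) (α d : Fin k → ℝ) (f : ℝ) : Prop where
  budget : f + ∑ j, d j ≤ 1
  mono : Monotone α
  metric : ∀ j l, α j ≤ α l + d j + d l
  contribution : ∀ j, ∑ l ∈ r j, max (α j - d l) 0 ≤ f
  α_nonneg : ∀ j, 0 ≤ α j
  d_nonneg : ∀ j, 0 ≤ d j
  f_nonneg : 0 ≤ f

theorem monotone_of_le_of_succ_eq {k : ℕ} {α : Fin k → ℝ}
    (h : ∀ j l : Fin k, (j : ℕ) + 1 = l → α j ≤ α l) : Monotone α := by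
  cases k with
  | zero => exact fun i => i.elim0
  | succ n => exact Fin.monotone_iff_le_succ.2 fun i => h _ _ (by simp)

theorem mem_lowerValues_iff {k : ℕ} {v : ℝ} :
    v ∈ lowerValues k ↔ ∃ α d f, StarProgram k Finset.Ici α d f ∧ v = ∑ j, α j := by
  constructor
  · rintro ⟨α, d, x, f, h, hx, rfl⟩
    refine ⟨α, d, f, ⟨h.budget, monotone_of_le_of_succ_eq h.mono, h.metric, fun j => ?_,
      h.α_nonneg, h.d_nonneg, h.f_nonneg⟩, rfl⟩
    refine (Finset.sum_le_sum fun l hl => ?_).trans (h.contribution j)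
    have hl := Finset.mem_Ici.1 hl
    exact max_le (hx j l hl) (h.x_nonneg j l hl)
  · rintro ⟨α, d, f, h, rfl⟩
    exact ⟨α, d, fun j l => max (α j - d l) 0, f,
      ⟨h.budget, fun j l hjl => h.mono (by rw [Fin.le_def]; omega), h.metric, h.contribution,
        h.α_nonneg, h.d_nonneg, h.f_nonneg, fun _ _ _ => le_max_right _ _⟩,
      fun _ _ _ => le_max_left _ _, rfl⟩

theorem mem_upperValues_iff {k : ℕ} {v : ℝ} :
    v ∈ upperValues k ↔ ∃ α d f, StarProgram k Finset.Ioi α d f ∧ v = ∑ j, α j := by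
  constructor
  · rintro ⟨α, d, x, f, h, hx, rfl⟩
    refine ⟨α, d, f, ⟨h.budget, monotone_of_le_of_succ_eq h.mono, h.metric, fun j => ?_,
      h.α_nonneg, h.d_nonneg, h.f_nonneg⟩, rfl⟩
    refine le_trans ?_ (h.contribution j)
    refine (Finset.sum_le_sum (g := fun l => x j l) fun l hl => ?_).trans ?_
    · have hl := Finset.mem_Ioi.1 hl
      exact max_le (hx j l hl) (h.x_nonneg j l hl.le)
    · exact Finset.sum_le_sum_of_subset_of_nonneg Finset.Ioi_subset_Ici_self
        fun l hl _ => h.x_nonneg j l (Finset.mem_Ici.1 hl)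
  · rintro ⟨α, d, f, h, rfl⟩
    refine ⟨α, d, fun j l => if j < l then max (α j - d l) 0 else 0, f,
      ⟨h.budget, fun j l hjl => h.mono (by rw [Fin.le_def]; omega), h.metric, fun j => ?_,
        h.α_nonneg, h.d_nonneg, h.f_nonneg, fun j l _ => ?_⟩, fun j l hjl => ?_, rfl⟩
    · refine le_of_eq_of_le ?_ (h.contribution j)
      rw [← Finset.sum_filter]
      refine Finset.sum_congr ?_ fun _ _ => rfl
      ext l
      simpa using fun hl : j < l => hl.le
    · split_ifs
      exacts [le_max_right _ _, le_rfl]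
    · simp [hjl]

/-- For `k ≥ 2` the feasible set is compact: every city but the last one is charged to some other
city, which bounds its budget by `1`, and the metric constraint then bounds the last budget. -/
theorem isCompact_starProgram {k : ℕ} (hk : 2 ≤ k) {r : Fin k → Finset (Fin k)}
    (hr : ∀ j, Finset.Ioi j ⊆ r j) :
    IsCompact {p : (Fin k → ℝ) × (Fin k → ℝ) × ℝ | StarProgram k r p.1 p.2.1 p.2.2} := by
  have hbox : IsCompact
      ((Set.univ.pi fun _ : Fin k => Set.Icc (0 : ℝ) 3) ×ˢ
        ((Set.univ.pi fun _ : Fin k => Set.Icc (0 : ℝ) 1) ×ˢ Set.Icc (0 : ℝ) 1)) :=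
    (isCompact_univ_pi fun _ => isCompact_Icc).prod
      ((isCompact_univ_pi fun _ => isCompact_Icc).prod isCompact_Icc)
  refine hbox.of_isClosed_subset ?_ ?_
  · have : {p : (Fin k → ℝ) × (Fin k → ℝ) × ℝ | StarProgram k r p.1 p.2.1 p.2.2} =
        {p | p.2.2 + ∑ j, p.2.1 j ≤ 1} ∩ (⋂ j, ⋂ l, {p | j ≤ l → p.1 j ≤ p.1 l}) ∩
        (⋂ j, ⋂ l, {p | p.1 j ≤ p.1 l + p.2.1 j + p.2.1 l}) ∩
        (⋂ j, {p | ∑ l ∈ r j, max (p.1 j - p.2.1 l) 0 ≤ p.2.2}) ∩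
        (⋂ j, {p | 0 ≤ p.1 j}) ∩ (⋂ j, {p | 0 ≤ p.2.1 j}) ∩ {p | 0 ≤ p.2.2} := by
      ext p
      simp only [Set.mem_inter_iff, Set.mem_iInter, Set.mem_ofPred_eq]
      exact ⟨fun h => ⟨⟨⟨⟨⟨⟨h.budget, fun _ _ hjl => h.mono hjl⟩, h.metric⟩, h.contribution⟩,
        h.α_nonneg⟩, h.d_nonneg⟩, h.f_nonneg⟩,
        fun ⟨⟨⟨⟨⟨⟨h1, h2⟩, h3⟩, h4⟩, h5⟩, h6⟩, h7⟩ => ⟨h1, fun j l => h2 j l, h3, h4, h5, h6, h7⟩⟩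
    rw [this]
    refine (((((IsClosed.inter ?_ ?_).inter ?_).inter ?_).inter ?_).inter ?_).inter ?_
    · exact isClosed_le (by fun_prop) (by fun_prop)
    · refine isClosed_iInter fun j => isClosed_iInter fun l => ?_
      by_cases hjl : j ≤ l
      · simpa [hjl] using isClosed_le (by fun_prop) (by fun_prop)
      · simp [hjl]
    · exact isClosed_iInter fun j => isClosed_iInter fun l =>
        isClosed_le (by fun_prop) (by fun_prop)
    · exact isClosed_iInter fun j => isClosed_le (by fun_prop) (by fun_prop)
    · exact isClosed_iInter fun j => isClosed_le (by fun_prop) (by fun_prop)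
    · exact isClosed_iInter fun j => isClosed_le (by fun_prop) (by fun_prop)
    · exact isClosed_le (by fun_prop) (by fun_prop)
  · rintro ⟨α, d, f⟩ h
    have hsum : ∀ j, d j ≤ ∑ j, d j := fun j =>
      Finset.single_le_sum (fun i _ => h.d_nonneg i) (Finset.mem_univ j)
    have hfd : ∀ j, f + d j ≤ 1 := fun j => by linarith [hsum j, h.budget]
    have hlt : ∀ j l : Fin k, j < l → α j ≤ 1 := by
      intro j l hjl
      have h1 : max (α j - d l) 0 ≤ f :=
        (Finset.single_le_sum (f := fun l => max (α j - d l) 0)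
          (fun i _ => le_max_right _ _) (hr j (Finset.mem_Ioi.2 hjl))).trans (h.contribution j)
      linarith [le_max_left (α j - d l) 0, hfd l]
    have hd1 : ∀ j, d j ≤ 1 := fun j => by linarith [hfd j, h.f_nonneg]
    refine ⟨fun j _ => ⟨h.α_nonneg j, ?_⟩, fun j _ => ⟨h.d_nonneg j, hd1 j⟩, h.f_nonneg, ?_⟩
    · have h0 : α ⟨0, by omega⟩ ≤ 1 := hlt _ ⟨1, by omega⟩ (by simp [Fin.lt_def])
      have h1 := h.metric j ⟨0, by omega⟩
      have h2 := hd1 j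
      have h3 := hd1 ⟨0, by omega⟩
      show α j ≤ 3
      linarith
    · show f ≤ 1
      linarith [hfd ⟨0, by omega⟩, h.d_nonneg ⟨0, by omega⟩]

theorem exists_isGreatest_starProgram {k : ℕ} (hk : 2 ≤ k) {r : Fin k → Finset (Fin k)}
    (hr : ∀ j, Finset.Ioi j ⊆ r j) :
    ∃ z, IsGreatest {v | ∃ α d f, StarProgram k r α d f ∧ v = ∑ j, α j} z := by
  have hne : {p : (Fin k → ℝ) × (Fin k → ℝ) × ℝ | StarProgram k r p.1 p.2.1 p.2.2}.Nonempty :=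
    ⟨(0, 0, 0), ⟨by simp, monotone_const, by simp, by simp, by simp, by simp, le_rfl⟩⟩
  obtain ⟨p, hp, hmax⟩ := (isCompact_starProgram hk hr).exists_isMaxOn hne
    (f := fun p => ∑ j, p.1 j) (by fun_prop)
  exact ⟨∑ j, p.1 j, ⟨p.1, p.2.1, p.2.2, hp, rfl⟩, by
    rintro _ ⟨α, d, f, h, rfl⟩
    exact hmax (a := (α, d, f)) h⟩

theorem exists_isGreatest_lowerValues {k : ℕ} (hk : 2 ≤ k) : ∃ z, IsGreatest (lowerValues k) z := by
  have : lowerValues k = {v | ∃ α d f, StarProgram k Finset.Ici α d f ∧ v = ∑ j, α j} :=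
    Set.ext fun _ => mem_lowerValues_iff
  rw [this]
  exact exists_isGreatest_starProgram hk fun _ => Finset.Ioi_subset_Ici_self

theorem exists_isGreatest_upperValues {k : ℕ} (hk : 2 ≤ k) : ∃ u, IsGreatest (upperValues k) u := by
  have : upperValues k = {v | ∃ α d f, StarProgram k Finset.Ioi α d f ∧ v = ∑ j, α j} :=
    Set.ext fun _ => mem_upperValues_iff
  rw [this]
  exact exists_isGreatest_starProgram hk fun _ => subset_rfl

/-! ### Invariants of the algorithm -/

namespace FLInstance

/-- What is known about a state reached at time `θ` (the common budget of the unconnected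
cities).  The field `offer_le` remembers all earlier moments `τ`: the cities whose budget is at
least `τ` are those that were unconnected just before `τ`. -/
structure Invariant {C F : Type} [Fintype C] (I : FLInstance C F) (s : State C F) (θ : ℝ) :
    Prop where
  budget_le : ∀ j, s.budget j ≤ θ
  budget_eq : ∀ j, s.conn j = none → s.budget j = θ
  budget_nonneg : ∀ j, 0 ≤ s.budget j
  conn_mem : ∀ j i, s.conn j = some i → i ∈ s.opened
  conn_le : ∀ j i, s.conn j = some i → I.c i j ≤ s.budget j
  le_open : ∀ i ∈ s.opened, ∀ j, s.conn j = none → θ ≤ I.c i j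
  le_conn : ∀ j l, s.budget l < s.budget j → ∃ i, s.conn l = some i ∧ s.budget j ≤ I.c i j
  offer_le : ∀ i, ∀ τ ≤ θ, ∑ l with τ ≤ s.budget l, max (τ - I.c i l) 0 ≤ I.f i
  cost_eq : I.stateCost s = ∑ j, if s.conn j = none then 0 else s.budget j

variable {C F : Type} [Fintype C]

theorem mem_unconnected {s : State C F} {j : C} : j ∈ s.unconnected ↔ s.conn j = none := by
  simp [State.unconnected]

theorem invariant_init (I : FLInstance C F) : I.Invariant State.init 0 where
  budget_le _ := le_rfl
  budget_eq _ _ := rfl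
  budget_nonneg _ := le_rfl
  conn_mem j i h := by simp [State.init] at h
  conn_le j i h := by simp [State.init] at h
  le_open i h := by simp [State.init] at h
  le_conn j l h := by simp [State.init] at h
  offer_le i τ hτ := by
    refine le_of_eq_of_le (Finset.sum_eq_zero fun l _ => ?_) (I.f_nonneg i)
    exact max_eq_right (by linarith [I.c_nonneg i l])
  cost_eq := by simp [stateCost, State.init]

/-- Raising the budgets keeps the invariant.  No budget can pass the distance to an open facility,
and no total offer can pass an opening cost, because the crossing would have been an event. -/
theorem Invariant.raise {I : FLInstance C F} {s t : State C F} {θ : ℝ} (h : I.Invariant s θ)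
    (hr : I.RaiseUntilEvent s t) : ∃ θ', I.Invariant t θ' := by
  obtain ⟨δ, hδ, hno, rfl, -⟩ := hr
  have hb : ∀ (δ : ℝ) j, (s.advance δ).budget j =
      if s.conn j = none then θ + δ else s.budget j := by
    intro δ j
    by_cases hj : s.conn j = none
    · simp [State.advance, hj, h.budget_eq j hj]
    · simp [State.advance, hj]
  have hU : ∀ δ : ℝ, (s.advance δ).unconnected = s.unconnected := fun _ => rfl
  have hopen : ∀ i ∈ s.opened, ∀ j, s.conn j = none → θ + δ ≤ I.c i j := by
    intro i hi j hj
    by_contra! hlt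
    refine hno (I.c i j - θ) (by linarith [h.le_open i hi j hj]) (by linarith)
      (Or.inl ⟨j, i, ?_, hi, ?_⟩)
    · rw [hU, mem_unconnected, hj]
    · rw [hb, if_pos hj]; ring
  have hle : ∀ j, (s.advance δ).budget j ≤ θ + δ := by
    intro j
    rw [hb]
    split_ifs
    · exact le_rfl
    · linarith [h.budget_le j]
  refine ⟨θ + δ, hle, fun j hj => ?_, fun j => ?_, h.conn_mem, fun j i hj => ?_, hopen,
    fun j l hjl => ?_, fun i τ hτ => ?_, ?_⟩
  · rw [hb]; exact if_pos hj
  · have := h.budget_nonneg j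
    rw [hb]
    split_ifs with hj
    · rw [h.budget_eq j hj] at this; linarith
    · exact this
  · rw [hb, if_neg (by change s.conn j = some i at hj; simp [hj])]
    exact h.conn_le j i hj
  · have hl : s.conn l ≠ none := fun hl => by
      have := hle j
      rw [hb δ l, if_pos hl] at hjl
      linarith
    rw [hb δ l, if_neg hl] at hjl
    by_cases hj : s.conn j = none
    · obtain ⟨i, hi⟩ := Option.ne_none_iff_exists'.1 hl
      rw [hb, if_pos hj]
      exact ⟨i, hi, hopen i (h.conn_mem l i hi) j hj⟩
    · rw [hb, if_neg hj] at hjl ⊢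
      exact h.le_conn j l hjl
  -- up to `θ` the set of cities in the sum is the old one, after `θ` it is the set of unconnected
  -- cities
  · rcases le_or_gt τ θ with hτθ | hτθ
    · refine le_of_eq_of_le (Finset.sum_congr (Finset.filter_congr fun l _ => ?_) fun _ _ => rfl)
        (h.offer_le i τ hτθ)
      rw [hb]
      split_ifs with hl
      · rw [h.budget_eq l hl]
        exact ⟨fun _ => hτθ, fun _ => by linarith⟩
      · rfl
    · have hset : (Finset.univ.filter fun l => τ ≤ (s.advance δ).budget l) = s.unconnected := by
        ext l
        rw [mem_unconnected, Finset.mem_filter, hb]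
        split_ifs with hl
        · simp [hl, hτ]
        · simp only [Finset.mem_univ, true_and, hl, iff_false, not_le]
          exact (h.budget_le l).trans_lt hτθ
      rw [hset]
      by_cases hi : i ∈ s.opened
      · refine le_of_eq_of_le (Finset.sum_eq_zero fun l hl => ?_) (I.f_nonneg i)
        exact max_eq_right (by linarith [hopen i hi l (mem_unconnected.1 hl)])
      · set g : ℝ → ℝ := fun x => ∑ l ∈ s.unconnected, max (x - I.c i l) 0 with hg
        have hmono : Monotone g := fun x y hxy => Finset.sum_le_sum fun l _ =>
          max_le_max (by linarith) le_rfl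
        have hgθ : g θ ≤ I.f i := by
          refine le_trans (Finset.sum_le_sum_of_subset_of_nonneg (fun l hl => ?_)
            fun _ _ _ => le_max_right _ _) (h.offer_le i θ le_rfl)
          simp [h.budget_eq l (mem_unconnected.1 hl)]
        have hcont : Continuous g := by fun_prop
        refine (hmono hτ).trans ?_
        -- the total offer is continuous in time, so exceeding `f i` would have been an event
        by_contra! hlt
        obtain ⟨x, ⟨hx1, hx2⟩, hx⟩ :=
          intermediate_value_Icc (by linarith : θ ≤ θ + δ) hcont.continuousOn ⟨hgθ, hlt.le⟩
        have hx3 : x < θ + δ := lt_of_le_of_ne hx2 fun h => by rw [h] at hx; linarith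
        refine hno (x - θ) (by linarith) (by linarith) (Or.inr ⟨i, hi, ?_⟩)
        rw [← hx, hU]
        refine Finset.sum_congr rfl fun l hl => ?_
        rw [hb, if_pos (mem_unconnected.1 hl)]
        ring_nf
  · rw [show I.stateCost (s.advance δ) = I.stateCost s from rfl, h.cost_eq]
    refine Finset.sum_congr rfl fun j _ => ?_
    change _ = if s.conn j = none then _ else _
    split_ifs with hj
    · rfl
    · rw [hb, if_neg hj]

theorem Invariant.connectCity {I : FLInstance C F} {s : State C F} {θ : ℝ} {j : C} {i : F}
    (h : I.Invariant s θ) (hev : I.ConnectEvent s j i) :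
    I.Invariant (FLInstance.connectCity s j i) θ := by
  classical
  obtain ⟨hj, hi, hji⟩ := hev
  rw [mem_unconnected] at hj
  have hc : ∀ l, (FLInstance.connectCity s j i).conn l = if l = j then some i else s.conn l := by
    intro l
    simp only [FLInstance.connectCity, Function.update_apply]
  refine ⟨h.budget_le, fun l hl => ?_, h.budget_nonneg, fun l i' hl => ?_, fun l i' hl => ?_,
    fun i' hi' l hl => ?_, fun l m hlm => ?_, h.offer_le, ?_⟩
  · rw [hc] at hl
    split_ifs at hl with hlj
    exact h.budget_eq l hl
  · rw [hc] at hl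
    split_ifs at hl with hlj
    · obtain rfl := Option.some.inj hl
      exact hi
    · exact h.conn_mem l i' hl
  · rw [hc] at hl
    split_ifs at hl with hlj
    · obtain rfl := Option.some.inj hl
      rw [hlj]
      exact hji.ge
    · exact h.conn_le l i' hl
  · rw [hc] at hl
    split_ifs at hl with hlj
    exact h.le_open i' hi' l hl
  · obtain ⟨i', hi', hle⟩ := h.le_conn l m hlm
    refine ⟨i', ?_, hle⟩
    rw [hc, if_neg (fun hm => by simp [hm, hj] at hi'), hi']
  · have h1 := h.cost_eq
    rw [stateCost] at h1 ⊢
    have h4 : ∀ l, (((FLInstance.connectCity s j i).conn l).elim 0 fun i => I.c i l) -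
        ((s.conn l).elim 0 fun i => I.c i l) =
        (if (FLInstance.connectCity s j i).conn l = none then 0 else s.budget l) -
        (if s.conn l = none then 0 else s.budget l) := by
      intro l
      rw [hc]
      by_cases hl : l = j
      · simp [hl, hj, hji]
      · simp [hl]
    have h5 := Finset.sum_congr rfl fun l (_ : l ∈ Finset.univ) => h4 l
    rw [Finset.sum_sub_distrib, Finset.sum_sub_distrib] at h5
    change ∑ i ∈ s.opened, I.f i + _ =
      ∑ l, if (FLInstance.connectCity s j i).conn l = none then 0 else s.budget l
    linarith

theorem Invariant.openFacility {I : FLInstance C F} {s : State C F} {θ : ℝ} {i : F}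
    (h : I.Invariant s θ) (hev : I.OpenEvent s i) :
    I.Invariant (I.openFacility s i) θ := by
  classical
  obtain ⟨hi, hsum⟩ := hev
  have hc : ∀ l, (I.openFacility s i).conn l =
      if s.conn l = none ∧ I.c i l ≤ θ then some i else s.conn l := by
    intro l
    simp only [FLInstance.openFacility, mem_unconnected]
    by_cases hl : s.conn l = none
    · simp [hl, h.budget_eq l hl]
    · simp [hl]
  have ho : (I.openFacility s i).opened = insert i s.opened := by
    simp only [FLInstance.openFacility]
  refine ⟨h.budget_le, fun l hl => ?_, h.budget_nonneg, fun l i' hl => ?_, fun l i' hl => ?_,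
    fun i' hi' l hl => ?_, fun l m hlm => ?_, h.offer_le, ?_⟩
  · rw [hc] at hl
    split_ifs at hl with hlj
    exact h.budget_eq l hl
  · rw [hc] at hl
    rw [ho]
    split_ifs at hl with hlj
    · obtain rfl := Option.some.inj hl
      exact Finset.mem_insert_self _ _
    · exact Finset.mem_insert_of_mem (h.conn_mem l i' hl)
  · rw [hc] at hl
    split_ifs at hl with hlj
    · obtain rfl := Option.some.inj hl
      exact hlj.2.trans (h.budget_eq l hlj.1).ge
    · exact h.conn_le l i' hl
  · rw [hc] at hl
    split_ifs at hl with hlj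
    rw [ho] at hi'
    rcases Finset.mem_insert.1 hi' with rfl | hi'
    · exact (not_le.1 fun hle => hlj ⟨hl, hle⟩).le
    · exact h.le_open i' hi' l hl
  · obtain ⟨i', hi', hle⟩ := h.le_conn l m hlm
    refine ⟨i', ?_, hle⟩
    rw [hc, if_neg (fun hm => by simp [hm.1] at hi'), hi']
  · have h1 := h.cost_eq
    rw [stateCost] at h1 ⊢
    rw [ho, Finset.sum_insert hi]
    have hf : I.f i = ∑ l, if s.conn l = none then max (θ - I.c i l) 0 else 0 := by
      rw [← hsum, ← Finset.sum_filter]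
      refine Finset.sum_congr (by ext l; simp [mem_unconnected]) fun l hl => ?_
      rw [h.budget_eq l (by simpa using hl)]
    have h4 : ∀ l, ((if s.conn l = none then max (θ - I.c i l) 0 else 0) +
        ((I.openFacility s i).conn l).elim 0 fun i => I.c i l) -
        ((s.conn l).elim 0 fun i => I.c i l) =
        (if (I.openFacility s i).conn l = none then 0 else s.budget l) -
        (if s.conn l = none then 0 else s.budget l) := by
      intro l
      rw [hc]
      by_cases hl : s.conn l = none
      · by_cases hle : I.c i l ≤ θ
        · simp [hl, hle, h.budget_eq l hl]
        · simp [hl, hle, (not_le.1 hle).le]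
      · simp [hl]
    have h5 := Finset.sum_congr rfl fun l (_ : l ∈ Finset.univ) => h4 l
    rw [Finset.sum_sub_distrib, Finset.sum_sub_distrib, Finset.sum_add_distrib, ← hf] at h5
    change _ = ∑ j, if (I.openFacility s i).conn j = none then 0 else s.budget j
    linarith

theorem exists_invariant_of_reachable {I : FLInstance C F} {s : State C F}
    (h : Relation.ReflTransGen I.Step State.init s) : ∃ θ, I.Invariant s θ := by
  induction h with
  | refl => exact ⟨0, I.invariant_init⟩
  | tail _ hstep ih =>
    obtain ⟨θ, hθ⟩ := ih
    cases hstep with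
    | connect hU hr hev =>
      obtain ⟨θ', h'⟩ := hθ.raise hr
      exact ⟨θ', h'.connectCity hev⟩
    | openFac hU hr hev =>
      obtain ⟨θ', h'⟩ := hθ.raise hr
      exact ⟨θ', h'.openFacility hev⟩

theorem IsOutput.stateCost_eq {I : FLInstance C F} {s : State C F} (h : I.IsOutput s) :
    I.stateCost s = ∑ j, s.budget j := by
  obtain ⟨θ, hθ⟩ := exists_invariant_of_reachable h.1
  rw [hθ.cost_eq]
  refine Finset.sum_congr rfl fun j _ => if_neg fun hj => ?_
  have := mem_unconnected.2 hj
  simp [h.2] at this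

theorem IsOutput.budget_nonneg {I : FLInstance C F} {s : State C F} (h : I.IsOutput s) (j : C) :
    0 ≤ s.budget j := by
  obtain ⟨θ, hθ⟩ := exists_invariant_of_reachable h.1
  exact hθ.budget_nonneg j

/-- If `j` outlives `l`, the facility serving `l` is open while `j` is still unconnected, so it is
at distance at least `s.budget j` from `j`. -/
theorem IsOutput.budget_le_add {I : FLInstance C F} (hI : I.IsMetric) {s : State C F}
    (h : I.IsOutput s) (i : F) (j l : C) :
    s.budget j ≤ s.budget l + I.c i j + I.c i l := by
  obtain ⟨θ, hθ⟩ := exists_invariant_of_reachable h.1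
  rcases le_or_gt (s.budget j) (s.budget l) with hle | hlt
  · linarith [I.c_nonneg i j, I.c_nonneg i l]
  · obtain ⟨i', hi', hj⟩ := hθ.le_conn j l hlt
    linarith [hθ.conn_le l i' hi', hI i' i j l]

/-- The contribution constraint of a star, with the cities ordered by their final budgets and equal
budgets counted on both sides of a tie. -/
theorem IsOutput.offer_le {I : FLInstance C F} {s : State C F} (h : I.IsOutput s) (i : F) (j : C) :
    ∑ l with s.budget j ≤ s.budget l, max (s.budget j - I.c i l) 0 ≤ I.f i := by
  obtain ⟨θ, hθ⟩ := exists_invariant_of_reachable h.1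
  exact hθ.offer_le i _ (hθ.budget_le j)

end FLInstance

/-! ### The upper program bounds every star -/

/-- The bound of the upper program without the normalisation `f + ∑ j, d j ≤ 1`. -/
theorem sum_le_mul_of_mem_upperBounds {k : ℕ} {u : ℝ} (hu : u ∈ upperBounds (upperValues k))
    {α d : Fin k → ℝ} {f : ℝ} (mono : Monotone α) (metric : ∀ j l, α j ≤ α l + d j + d l)
    (contribution : ∀ j, ∑ l ∈ Finset.Ioi j, max (α j - d l) 0 ≤ f)
    (α_nonneg : ∀ j, 0 ≤ α j) (d_nonneg : ∀ j, 0 ≤ d j) (f_nonneg : 0 ≤ f) :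
    ∑ j, α j ≤ u * (f + ∑ j, d j) := by
  have hsc : ∀ c : ℝ, 0 ≤ c → c * (f + ∑ j, d j) ≤ 1 → c * ∑ j, α j ≤ u := by
    intro c hc hT
    refine hu (mem_upperValues_iff.2 ⟨fun j => c * α j, fun j => c * d j, c * f,
      ⟨?_, fun i j hij => mul_le_mul_of_nonneg_left (mono hij) hc, fun j l => ?_, fun j => ?_,
        fun j => mul_nonneg hc (α_nonneg j), fun j => mul_nonneg hc (d_nonneg j),
        mul_nonneg hc f_nonneg⟩, Finset.mul_sum _ _ _⟩)
    · rw [← Finset.mul_sum, ← mul_add]; exact hT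
    · rw [← mul_add, ← mul_add]
      exact mul_le_mul_of_nonneg_left (metric j l) hc
    · refine le_of_eq_of_le ?_ (mul_le_mul_of_nonneg_left (contribution j) hc)
      rw [Finset.mul_sum]
      refine Finset.sum_congr rfl fun l _ => ?_
      rw [← mul_sub, mul_max_of_nonneg _ _ hc, mul_zero]
  have hT : 0 ≤ f + ∑ j, d j := add_nonneg f_nonneg (Finset.sum_nonneg fun j _ => d_nonneg j)
  rcases hT.eq_or_lt with hT | hT
  · -- budgets of zero total cost can be scaled up arbitrarily, so they vanish
    rw [← hT, mul_zero]
    by_contra! hpos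
    have := hsc ((|u| + 1) / ∑ j, α j) (by positivity) (by rw [← hT]; simp)
    rw [div_mul_cancel₀ _ hpos.ne'] at this
    linarith [le_abs_self u]
  · have := hsc (f + ∑ j, d j)⁻¹ (by positivity) (by rw [inv_mul_cancel₀ hT.ne'])
    rwa [inv_mul_le_iff₀ hT, mul_comm] at this

theorem sum_range_sum_range_mul_add (g : ℕ → ℝ) (k m : ℕ) :
    ∑ j ∈ Finset.range k, ∑ x ∈ Finset.range m, g (j * m + x) =
      ∑ n ∈ Finset.range (k * m), g n := by
  induction k with
  | zero => simp
  | succ k ih => rw [Finset.sum_range_succ, ih, Nat.succ_mul, Finset.sum_range_add]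

theorem sum_range_mul_div (h : ℕ → ℝ) {k : ℕ} (hk : 0 < k) (m : ℕ) :
    ∑ n ∈ Finset.range (k * m), h (n / k) = k * ∑ r ∈ Finset.range m, h r := by
  rw [mul_comm k m, ← sum_range_sum_range_mul_add, Finset.mul_sum]
  refine Finset.sum_congr rfl fun r _ => ?_
  rw [Finset.sum_congr (g := fun _ => h r) rfl fun x hx => ?_]
  · simp
  · rw [mul_comm r k, Nat.mul_add_div hk, Nat.div_eq_of_lt (Finset.mem_range.1 hx), add_zero]

/-- Summing over the `j`-th of `k` groups of `m` consecutive copies, when every one of `m` items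
is repeated `k` times. -/
theorem sum_fin_sum_range_div (h : ℕ → ℝ) {k : ℕ} (hk : 0 < k) (m : ℕ) :
    ∑ j : Fin k, ∑ x ∈ Finset.range m, h ((j * m + x) / k) = k * ∑ r ∈ Finset.range m, h r := by
  rw [Fin.sum_univ_eq_sum_range fun j => ∑ x ∈ Finset.range m, h ((j * m + x) / k),
    sum_range_sum_range_mul_add fun n => h (n / k), sum_range_mul_div h hk]

/-- The bound of the `k`-th program applies to sequences of any length `m`: every term is repeated
`k` times and the `k * m` terms obtained are merged into `k` groups of `m` consecutive ones.  Since
a group is not charged to itself, the merged sequence is feasible for the upper program. -/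
theorem sum_range_le_mul_of_mem_upperBounds {k : ℕ} (hk : 0 < k) {u : ℝ}
    (hu : u ∈ upperBounds (upperValues k)) {m : ℕ} (hm : 0 < m) {a δ : ℕ → ℝ} {f : ℝ}
    (mono : ∀ p q, p ≤ q → q < m → a p ≤ a q)
    (metric : ∀ p q, p < m → q < m → a p ≤ a q + δ p + δ q)
    (contribution : ∀ p < m, ∑ r ∈ Finset.range m with p ≤ r, max (a p - δ r) 0 ≤ f)
    (a_nonneg : ∀ p < m, 0 ≤ a p) (δ_nonneg : ∀ p < m, 0 ≤ δ p) (f_nonneg : 0 ≤ f) :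
    ∑ p ∈ Finset.range m, a p ≤ u * (f + ∑ p ∈ Finset.range m, δ p) := by
  have hlt : ∀ (j : Fin k), ∀ x < m, (j * m + x) / k < m := by
    intro j x hx
    rw [Nat.div_lt_iff_lt_mul hk]
    calc (j : ℕ) * m + x < (j + 1) * m := by rw [Nat.succ_mul]; omega
      _ ≤ m * k := by rw [mul_comm]; exact Nat.mul_le_mul_left _ j.2
  have key := sum_le_mul_of_mem_upperBounds hu (f := k * f)
    (α := fun j : Fin k => ∑ x ∈ Finset.range m, a ((j * m + x) / k))
    (d := fun j : Fin k => ∑ x ∈ Finset.range m, δ ((j * m + x) / k))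
    (fun i j hij => Finset.sum_le_sum fun x hx => mono _ _ (Nat.div_le_div_right
      (Nat.add_le_add_right (Nat.mul_le_mul_right _ hij) _)) (hlt j x (Finset.mem_range.1 hx)))
    (fun j l => by
      rw [← Finset.sum_add_distrib, ← Finset.sum_add_distrib]
      exact Finset.sum_le_sum fun x hx => metric _ _ (hlt j x (Finset.mem_range.1 hx))
        (hlt l x (Finset.mem_range.1 hx)))
    (fun j => by
      have hp := hlt j (m - 1) (by omega)
      -- `p` is the last item of the group `j`, hence the one of largest budget
      set p := (j * m + (m - 1)) / k with hpdef
      have h1 : ∀ l ∈ Finset.Ioi j, max ((∑ x ∈ Finset.range m, a ((j * m + x) / k)) -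
          ∑ x ∈ Finset.range m, δ ((l * m + x) / k)) 0 ≤
          ∑ x ∈ Finset.range m, if p ≤ (l * m + x) / k then
            max (a p - δ ((l * m + x) / k)) 0 else 0 := by
        intro l hl
        have hjl : (j : ℕ) + 1 ≤ l := Finset.mem_Ioi.1 hl
        refine max_le ?_ (Finset.sum_nonneg fun x _ => ?_)
        · rw [← Finset.sum_sub_distrib]
          refine Finset.sum_le_sum fun x hx => ?_
          have hx := Finset.mem_range.1 hx
          have h2 : p ≤ (l * m + x) / k := by
            refine Nat.div_le_div_right ?_
            have := Nat.mul_le_mul_right m hjl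
            rw [Nat.succ_mul] at this
            omega
          rw [if_pos h2]
          refine le_trans ?_ (le_max_left _ _)
          exact sub_le_sub_right (mono _ _ (Nat.div_le_div_right (by omega)) hp) _
        · split_ifs
          exacts [le_max_right _ _, le_rfl]
      refine (Finset.sum_le_sum h1).trans ?_
      refine (Finset.sum_le_sum_of_subset_of_nonneg (Finset.subset_univ _)
        fun l _ _ => Finset.sum_nonneg fun x _ => ?_).trans ?_
      · split_ifs
        exacts [le_max_right _ _, le_rfl]
      · rw [sum_fin_sum_range_div (fun n => if p ≤ n then max (a p - δ n) 0 else 0) hk,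
          ← Finset.sum_filter]
        exact mul_le_mul_of_nonneg_left (contribution p hp) (Nat.cast_nonneg k))
    (fun j => Finset.sum_nonneg fun x hx => a_nonneg _ (hlt j x (Finset.mem_range.1 hx)))
    (fun j => Finset.sum_nonneg fun x hx => δ_nonneg _ (hlt j x (Finset.mem_range.1 hx)))
    (by positivity)
  rw [sum_fin_sum_range_div a hk, sum_fin_sum_range_div δ hk, ← mul_add, mul_left_comm] at key
  exact le_of_mul_le_mul_left key (by exact_mod_cast hk)

/-- The star inequality: the bound of the `k`-th upper program for a facility of cost `f` and an
arbitrary finite set `A` of cities. -/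
theorem sum_finset_le_mul_of_mem_upperBounds {k : ℕ} (hk : 0 < k) {u : ℝ}
    (hu : u ∈ upperBounds (upperValues k)) {C : Type} (A : Finset C) {α d : C → ℝ} {f : ℝ}
    (metric : ∀ j l, α j ≤ α l + d j + d l)
    (contribution : ∀ j, ∑ l ∈ A with α j ≤ α l, max (α j - d l) 0 ≤ f)
    (α_nonneg : ∀ j, 0 ≤ α j) (d_nonneg : ∀ j, 0 ≤ d j) (f_nonneg : 0 ≤ f) :
    ∑ j ∈ A, α j ≤ u * (f + ∑ j ∈ A, d j) := by
  have hu0 : 0 ≤ u := hu (mem_upperValues_iff.2 ⟨0, 0, 0,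
    ⟨by simp, monotone_const, by simp, by simp, by simp, by simp, le_rfl⟩, by simp⟩)
  rcases A.eq_empty_or_nonempty with rfl | hA
  · simpa using mul_nonneg hu0 f_nonneg
  obtain ⟨e, he⟩ : ∃ e : Fin A.card ≃ A, Monotone fun i => α (e i) :=
    ⟨(Tuple.sort fun i => α (A.equivFin.symm i)).trans A.equivFin.symm,
      Tuple.monotone_sort fun i => α (A.equivFin.symm i)⟩
  have hm : 0 < A.card := hA.card_pos
  obtain ⟨j₀, -⟩ := hA
  set c : ℕ → C := fun p => if h : p < A.card then e ⟨p, h⟩ else j₀ with hc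
  have hcp : ∀ p (h : p < A.card), c p = e ⟨p, h⟩ := fun p h => dif_pos h
  have hmono : ∀ p q, p ≤ q → q < A.card → α (c p) ≤ α (c q) := by
    intro p q hpq hq
    rw [hcp p (hpq.trans_lt hq), hcp q hq]
    exact he (by simpa [Fin.le_def] using hpq)
  have hsum : ∀ g : C → ℝ, ∑ p ∈ Finset.range A.card, g (c p) = ∑ j ∈ A, g j := by
    intro g
    rw [← Fin.sum_univ_eq_sum_range fun p => g (c p), ← Finset.sum_coe_sort A,
      ← Equiv.sum_comp e]
    exact Finset.sum_congr rfl fun i _ => by rw [hcp i i.2]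
  have key := sum_range_le_mul_of_mem_upperBounds hk hu hm (a := fun p => α (c p))
    (δ := fun p => d (c p)) (f := f) hmono (fun p q _ _ => metric _ _) (fun p hp => ?_)
    (fun _ _ => α_nonneg _) (fun _ _ => d_nonneg _) f_nonneg
  · rwa [hsum, hsum] at key
  · refine le_trans ?_ (contribution (c p))
    rw [Finset.sum_filter, Finset.sum_filter, ← hsum]
    refine Finset.sum_le_sum fun r hr => ?_
    by_cases hpr : p ≤ r
    · rw [if_pos hpr, if_pos (hmono p r hpr (Finset.mem_range.1 hr))]
    · rw [if_neg hpr]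
      split_ifs
      exacts [le_max_right _ _, le_rfl]

/-! ### Approximation guarantees -/

/-- Dual fitting: the cost of the output is the sum of the budgets, and the star inequality is applied
to every facility of the given solution with the cities assigned to it. -/
theorem isA1MetricApprox_of_mem_upperBounds {k : ℕ} (hk : 0 < k) {u : ℝ}
    (hu : u ∈ upperBounds (upperValues k)) : IsA1MetricApprox u := by
  classical
  intro C F _ _ I hI s hs S
  rw [hs.stateCost_eq, FLInstance.solutionCost,
    ← Finset.sum_fiberwise_of_maps_to (fun j _ => S.assign_mem j) s.budget,
    ← Finset.sum_fiberwise_of_maps_to (fun j _ => S.assign_mem j) fun j => I.c (S.assign j) j,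
    ← Finset.sum_add_distrib, Finset.mul_sum]
  refine Finset.sum_le_sum fun i _ => ?_
  have h := sum_finset_le_mul_of_mem_upperBounds hk hu (Finset.univ.filter fun j => S.assign j = i)
    (α := s.budget) (d := I.c i) (f := I.f i) (fun j l => hs.budget_le_add hI i j l) (fun j => ?_)
    hs.budget_nonneg (I.c_nonneg i) (I.f_nonneg i)
  · refine h.trans_eq ?_
    congr 2
    exact Finset.sum_congr rfl fun j hj => by rw [(Finset.mem_filter.1 hj).2]
  · refine (Finset.sum_le_sum_of_subset_of_nonneg ?_ fun _ _ _ => le_max_right _ _).trans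
      (hs.offer_le i j)
    exact Finset.filter_subset_filter _ (Finset.subset_univ _)

/-- The set of approximation guarantees is closed, so a lower bound turns its infimum into a least
element. -/
theorem isA1MetricFactor_sInf {z : ℝ} (hz : z ∈ lowerBounds {γ | IsA1MetricApprox γ})
    (hne : ∃ γ, IsA1MetricApprox γ) : IsA1MetricFactor (sInf {γ | IsA1MetricApprox γ}) := by
  have hbdd : BddBelow {γ | IsA1MetricApprox γ} := ⟨z, hz⟩
  refine ⟨?_, fun γ hγ => csInf_le hbdd hγ⟩
  intro C F _ _ I hI s hs S
  have hcost : 0 ≤ I.solutionCost S := add_nonneg (Finset.sum_nonneg fun i _ => I.f_nonneg i)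
    (Finset.sum_nonneg fun j _ => I.c_nonneg _ j)
  rcases hcost.eq_or_lt with h0 | hpos
  · obtain ⟨γ, hγ⟩ := hne
    have := hγ C F I hI s hs S
    rwa [← h0, mul_zero] at this ⊢
  · rw [← div_le_iff₀ hpos]
    exact le_csInf hne fun γ hγ => (div_le_iff₀ hpos).2 (hγ C F I hI s hs S)

/-! ### Instances realising the lower program -/

/-- The instance realising a feasible solution of the lower program.  The facility `none` has
opening cost `f` and lies at distance `d j` from the city `j`; next to every city `j` there is a
free facility `some j` at distance `α j`; all other distances are those of the resulting tree. -/
def spiderInstance {k : ℕ} (α d : Fin k → ℝ) (f : ℝ) (hα : ∀ j, 0 ≤ α j) (hd : ∀ j, 0 ≤ d j)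
    (hf : 0 ≤ f) : FLInstance (Fin k) (Option (Fin k)) where
  c i j := i.elim (d j) fun a => if a = j then α j else α a + d a + d j
  f i := i.elim f fun _ => 0
  c_nonneg i j := by
    cases i with
    | none => exact hd j
    | some a =>
      simp only [Option.elim_some]
      split_ifs
      exacts [hα j, add_nonneg (add_nonneg (hα a) (hd a)) (hd j)]
  f_nonneg i := by
    cases i with
    | none => exact hf
    | some a => exact le_rfl

namespace spiderInstance

variable {k : ℕ} {α d : Fin k → ℝ} {f : ℝ} {hα : ∀ j, 0 ≤ α j} {hd : ∀ j, 0 ≤ d j} {hf : 0 ≤ f}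

theorem isMetric : (spiderInstance α d f hα hd hf).IsMetric := by
  intro i i' j j'
  have h1 := hα j
  have h2 := hα j'
  have h3 := hd j
  have h4 := hd j'
  have h5 : ∀ a : Fin k, 0 ≤ α a ∧ 0 ≤ d a := fun a => ⟨hα a, hd a⟩
  cases i with
  | none =>
    cases i' with
    | none => simp only [spiderInstance, Option.elim_none]; linarith
    | some b =>
      have := h5 b
      simp only [spiderInstance, Option.elim_none, Option.elim_some]
      split_ifs <;> (try subst_vars) <;> linarith
  | some a =>
    have := h5 a
    cases i' with
    | none =>
      simp only [spiderInstance, Option.elim_none, Option.elim_some]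
      split_ifs <;> (try subst_vars) <;> linarith
    | some b =>
      have := h5 b
      simp only [spiderInstance, Option.elim_some]
      split_ifs <;> (try subst_vars) <;> first | linarith | (exfalso; simp_all)

theorem le_c_some (metric : ∀ j l, α j ≤ α l + d j + d l) (a j : Fin k) :
    α j ≤ (spiderInstance α d f hα hd hf).c (some a) j := by
  simp only [spiderInstance, Option.elim_some]
  split_ifs
  · exact le_rfl
  · linarith [metric j a]

/-- The free facilities can be opened at time `0`, one by one. -/
theorem exists_opened (metric : ∀ j l, α j ≤ α l + d j + d l) (B : Finset (Fin k)) :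
    (∃ s, (spiderInstance α d f hα hd hf).IsOutput s ∧ ∀ j, α j ≤ s.budget j) ∨
    ∃ s, Relation.ReflTransGen (spiderInstance α d f hα hd hf).Step FLInstance.State.init s ∧
      s.opened = B.map Function.Embedding.some ∧ (∀ j, s.conn j = none → s.budget j = 0) ∧
      ∀ j, s.conn j ≠ none → α j ≤ s.budget j := by
  classical
  set I := spiderInstance α d f hα hd hf with hI
  induction B using Finset.induction_on with
  | empty =>
    exact Or.inr ⟨_, Relation.ReflTransGen.refl, rfl, fun _ _ => rfl, fun j hj => (hj rfl).elim⟩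
  | insert a B ha ih =>
    rcases ih with h | ⟨s, hs, hopen, hzero, hle⟩
    · exact Or.inl h
    rcases s.unconnected.eq_empty_or_nonempty with hU | hU
    · refine Or.inl ⟨s, ⟨hs, hU⟩, fun j => hle j fun hj => ?_⟩
      have := FLInstance.mem_unconnected.2 hj
      simp [hU] at this
    · have hev : I.OpenEvent s (some a) := by
        refine ⟨by simp [hopen, ha], Finset.sum_eq_zero fun j hj => max_eq_right ?_⟩
        rw [hzero j (FLInstance.mem_unconnected.1 hj)]
        linarith [I.c_nonneg (some a) j]
      have hr : I.RaiseUntilEvent s s :=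
        ⟨0, le_rfl, fun δ h1 h2 => by linarith, by simp [FLInstance.State.advance],
          Or.inr ⟨_, hev⟩⟩
      refine Or.inr ⟨_, hs.tail (.openFac hU hr hev), ?_, fun j hj => ?_, fun j hj => ?_⟩
      · ext i
        simp [FLInstance.openFacility, hopen]
      · simp only [FLInstance.openFacility] at hj ⊢
        split_ifs at hj
        exact hzero j hj
      · simp only [FLInstance.openFacility] at hj ⊢
        split_ifs at hj with h
        · exact (le_c_some metric a j).trans h.2
        · exact hle j hj

/-- Once the free facilities are open, the cities can be connected to them in order, the city `j`
at time `α j`: the offers to the facility `none` never exceed its opening cost. -/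
theorem exists_output (metric : ∀ j l, α j ≤ α l + d j + d l) (mono : Monotone α)
    (contribution : ∀ j, ∑ l ∈ Finset.Ici j, max (α j - d l) 0 ≤ f) (f_pos : 0 < f) (n : ℕ) :
    ∀ (s : FLInstance.State (Fin k) (Option (Fin k))) (θ : ℝ),
      Relation.ReflTransGen (spiderInstance α d f hα hd hf).Step FLInstance.State.init s →
      s.opened = Finset.univ.map Function.Embedding.some → s.unconnected.card = n →
      (∀ j, s.conn j = none → s.budget j = θ) → (∀ j, s.conn j = none → θ ≤ α j) →
      (∀ j, s.conn j ≠ none → α j ≤ s.budget j) →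
      ∃ s, (spiderInstance α d f hα hd hf).IsOutput s ∧ ∀ j, α j ≤ s.budget j := by
  classical
  set I := spiderInstance α d f hα hd hf with hI
  induction n with
  | zero =>
    intro s θ hs _ hn _ _ hle
    have hU := Finset.card_eq_zero.1 hn
    refine ⟨s, ⟨hs, hU⟩, fun j => hle j fun hj => ?_⟩
    have := FLInstance.mem_unconnected.2 hj
    simp [hU] at this
  | succ n ih =>
    intro s θ hs hopen hn hθ hθα hle
    have hU : s.unconnected.Nonempty := Finset.card_pos.1 (by omega)
    set j := s.unconnected.min' hU with hj
    have hjU : j ∈ s.unconnected := Finset.min'_mem _ _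
    have hj0 := FLInstance.mem_unconnected.1 hjU
    have hjl : ∀ l ∈ s.unconnected, j ≤ l := fun l hl => Finset.min'_le _ _ hl
    have hb : ∀ δ l, l ∈ s.unconnected → (s.advance δ).budget l = θ + δ := by
      intro δ l hl
      have hl := FLInstance.mem_unconnected.1 hl
      simp [FLInstance.State.advance, hl, hθ l hl]
    have hbc : ∀ δ l, s.conn l ≠ none → (s.advance δ).budget l = s.budget l := by
      intro δ l hl
      simp [FLInstance.State.advance, hl]
    have hev : I.ConnectEvent (s.advance (α j - θ)) j (some j) := by
      refine ⟨hjU, ?_, ?_⟩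
      · change some j ∈ s.opened
        simp [hopen]
      · rw [hb _ _ hjU]
        simp [hI, spiderInstance]
    have hr : I.RaiseUntilEvent s (s.advance (α j - θ)) := by
      refine ⟨α j - θ, by linarith [hθα j hj0], fun δ h1 h2 => ?_, rfl, Or.inl ⟨_, _, hev⟩⟩
      rintro (⟨l, i, hl, hi, hli⟩ | ⟨i, hi, hsum⟩)
      · change l ∈ s.unconnected at hl
        change i ∈ s.opened at hi
        rw [hopen] at hi
        obtain ⟨b, -, rfl⟩ := Finset.mem_map.1 hi
        rw [hb _ _ hl] at hli
        have h3 : α l ≤ I.c (some b) l := le_c_some metric b l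
        change θ + δ = I.c (some b) l at hli
        linarith [mono (hjl l hl)]
      · cases i with
        | some b =>
          refine hi ?_
          change some b ∈ s.opened
          simp [hopen]
        | none =>
          change ∑ l ∈ s.unconnected, max ((s.advance δ).budget l - d l) 0 = f at hsum
          rw [Finset.sum_congr rfl fun l hl => by rw [hb δ l hl]] at hsum
          -- a positive total offer still grows strictly until time `α j`, where it is at most `f`
          obtain ⟨l, hl, hpos⟩ : ∃ l ∈ s.unconnected, 0 < max (θ + δ - d l) 0 := by
            by_contra! hno
            linarith [Finset.sum_nonpos hno]
          have h4 : ∑ l ∈ s.unconnected, max (θ + δ - d l) 0 <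
              ∑ l ∈ s.unconnected, max (α j - d l) 0 := by
            refine Finset.sum_lt_sum (fun l _ => max_le_max (by linarith) le_rfl) ⟨l, hl, ?_⟩
            have h5 : 0 < θ + δ - d l := by simpa using hpos
            rw [max_eq_left h5.le]
            exact lt_of_lt_of_le (by linarith) (le_max_left _ _)
          have h6 : ∑ l ∈ s.unconnected, max (α j - d l) 0 ≤ f :=
            (Finset.sum_le_sum_of_subset_of_nonneg (fun l hl => Finset.mem_Ici.2 (hjl l hl))
              fun _ _ _ => le_max_right _ _).trans (contribution j)
          linarith
    have hc : ∀ l, (FLInstance.connectCity (s.advance (α j - θ)) j (some j)).conn l =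
        if l = j then some (some j) else s.conn l := by
      intro l
      by_cases hlj : l = j <;>
        simp [FLInstance.connectCity, FLInstance.State.advance, hlj]
    refine ih (FLInstance.connectCity (s.advance (α j - θ)) j (some j)) (α j)
      (hs.tail (.connect hU hr hev)) hopen ?_ (fun l hl => ?_) (fun l hl => ?_) fun l hl => ?_
    · have : (FLInstance.connectCity (s.advance (α j - θ)) j (some j)).unconnected =
          s.unconnected.erase j := by
        ext l
        rw [FLInstance.mem_unconnected, hc, Finset.mem_erase, FLInstance.mem_unconnected]
        split_ifs with h <;> simp [h]
      rw [this, Finset.card_erase_of_mem hjU, hn, Nat.add_sub_cancel]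
    · rw [hc] at hl
      split_ifs at hl
      change (s.advance (α j - θ)).budget l = _
      rw [hb _ _ (FLInstance.mem_unconnected.2 hl)]
      ring
    · rw [hc] at hl
      split_ifs at hl
      exact mono (hjl l (FLInstance.mem_unconnected.2 hl))
    · change _ ≤ (s.advance (α j - θ)).budget l
      by_cases hl0 : s.conn l = none
      · have hlj : l = j := by
          by_contra hlj
          rw [hc, if_neg hlj] at hl
          exact hl hl0
        rw [hb _ _ (FLInstance.mem_unconnected.2 hl0), hlj]
        linarith
      · rw [hbc _ _ hl0]
        exact hle l hl0

end spiderInstance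

/-- Every value above `1` of the lower program is a lower bound for the approximation guarantees.
A value above `1` forces a positive opening cost, which `spiderInstance.exists_output` needs. -/
theorem le_of_isA1MetricApprox {k : ℕ} {v γ : ℝ} (hv : v ∈ lowerValues k) (hv1 : 1 < v)
    (hγ : IsA1MetricApprox γ) : v ≤ γ := by
  obtain ⟨α, d, f, h, rfl⟩ := mem_lowerValues_iff.1 hv
  have hf : 0 < f := by
    refine h.f_nonneg.lt_of_ne fun hf => ?_
    have hle : ∀ j, α j ≤ d j := fun j => by
      have h1 := (Finset.single_le_sum (f := fun l => max (α j - d l) 0)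
        (fun i _ => le_max_right _ _) (Finset.mem_Ici.2 (le_refl j))).trans (h.contribution j)
      linarith [le_max_left (α j - d j) 0]
    linarith [Finset.sum_le_sum fun j (_ : j ∈ Finset.univ) => hle j, h.budget]
  obtain ⟨s, hs, hle⟩ : ∃ s, (spiderInstance α d f h.α_nonneg h.d_nonneg h.f_nonneg).IsOutput s ∧
      ∀ j, α j ≤ s.budget j := by
    rcases spiderInstance.exists_opened (hα := h.α_nonneg) (hd := h.d_nonneg) (hf := h.f_nonneg)
      h.metric Finset.univ with h' | ⟨s, hs, hopen, hzero, hle⟩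
    · exact h'
    · exact spiderInstance.exists_output h.metric h.mono h.contribution hf _ s 0 hs hopen rfl hzero
        (fun j _ => h.α_nonneg j) hle
  have h1 := hγ _ _ _ spiderInstance.isMetric s hs
    ⟨{none}, fun _ => none, fun _ => Finset.mem_singleton_self _⟩
  rw [hs.stateCost_eq] at h1
  have h2 : (spiderInstance α d f h.α_nonneg h.d_nonneg h.f_nonneg).solutionCost
      ⟨{none}, fun _ => none, fun _ => Finset.mem_singleton_self _⟩ = f + ∑ j, d j := by
    simp [FLInstance.solutionCost, spiderInstance]
  rw [h2] at h1
  have h3 := Finset.sum_le_sum fun j (_ : j ∈ Finset.univ) => hle j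
  have h4 : 0 ≤ f + ∑ j, d j := add_nonneg hf.le (Finset.sum_nonneg fun j _ => h.d_nonneg j)
  have h5 : 0 ≤ γ := by
    by_contra! hneg
    linarith [mul_nonpos_of_nonpos_of_nonneg hneg.le h4]
  linarith [mul_le_of_le_one_right h5 h.budget]

/-! ### Weak duality for the upper program -/

/-- Weak duality for the upper program.  The contribution constraint of the city `j`, restricted to
the cities `l` with `j < l < T j`, is taken with weight `w j`. -/
theorem sum_range_le_mul_of_dual {k : ℕ} {w : ℕ → ℝ} {T : ℕ → ℕ} {c : ℝ}
    (w_nonneg : ∀ j, 0 ≤ w j) (hT : ∀ j < k, j < T j ∧ T j ≤ k)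
    (hf : ∑ j ∈ Finset.range k, w j ≤ c)
    (hd : ∀ l < k, ∑ j ∈ Finset.range l with l < T j, w j + |1 - ((T l : ℝ) - 1 - l) * w l| ≤ c)
    (hs : (k : ℝ) ≤ ∑ j ∈ Finset.range k, ((T j : ℝ) - 1 - j) * w j)
    {a δ : ℕ → ℝ} {f : ℝ} (metric : ∀ j < k, ∀ l < k, a j ≤ a l + δ j + δ l)
    (contribution : ∀ j < k, ∑ l ∈ Finset.Ico (j + 1) k, max (a j - δ l) 0 ≤ f)
    (a_nonneg : ∀ j < k, 0 ≤ a j) (δ_nonneg : ∀ j < k, 0 ≤ δ j) (f_nonneg : 0 ≤ f) :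
    ∑ j ∈ Finset.range k, a j ≤ c * (f + ∑ j ∈ Finset.range k, δ j) := by
  rcases k.eq_zero_or_pos with rfl | hk
  · simpa using mul_nonneg (by simpa using hf) f_nonneg
  have hrow : ∀ j ∈ Finset.range k, ((T j : ℝ) - 1 - j) * w j * a j ≤
      w j * f + ∑ l ∈ Finset.Ico (j + 1) (T j), w j * δ l := by
    intro j hj
    obtain ⟨h1, h2⟩ := hT j (Finset.mem_range.1 hj)
    have h3 : ∑ l ∈ Finset.Ico (j + 1) (T j), (a j - δ l) ≤ f :=
      (Finset.sum_le_sum fun l _ => le_max_left _ _).trans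
        ((Finset.sum_le_sum_of_subset_of_nonneg (Finset.Ico_subset_Ico_right h2)
          fun _ _ _ => le_max_right _ _).trans (contribution j (Finset.mem_range.1 hj)))
    rw [Finset.sum_sub_distrib, Finset.sum_const, Nat.card_Ico, nsmul_eq_mul,
      Nat.cast_sub (by omega)] at h3
    push_cast at h3
    rw [← Finset.mul_sum, mul_right_comm, mul_comm _ (w j), ← mul_add]
    exact mul_le_mul_of_nonneg_left (by linarith) (w_nonneg j)
  have hswap : ∑ j ∈ Finset.range k, ∑ l ∈ Finset.Ico (j + 1) (T j), w j * δ l =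
      ∑ l ∈ Finset.range k, (∑ j ∈ Finset.range l with l < T j, w j) * δ l := by
    simp_rw [Finset.sum_mul]
    refine Finset.sum_comm' fun j l => ?_
    simp only [Finset.mem_range, Finset.mem_Ico, Finset.mem_filter]
    constructor
    · rintro ⟨h1, h2, h3⟩
      exact ⟨⟨by omega, h3⟩, h3.trans_le (hT j h1).2⟩
    · rintro ⟨⟨h1, h2⟩, h3⟩
      exact ⟨by omega, by omega, h2⟩
  -- `s` separates `a j - δ j` from `a j + δ j`, so `δ j` bounds the deviation of `a j` from `s`
  obtain ⟨l₀, hl₀k, hl₀⟩ := Finset.exists_min_image (Finset.range k) (fun l => a l + δ l)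
    ⟨0, Finset.mem_range.2 hk⟩
  have hl₀k := Finset.mem_range.1 hl₀k
  set s := a l₀ + δ l₀ with hsdef
  have hs0 : 0 ≤ s := add_nonneg (a_nonneg _ hl₀k) (δ_nonneg _ hl₀k)
  have hdev : ∀ j ∈ Finset.range k, (1 - ((T j : ℝ) - 1 - j) * w j) * (a j - s) ≤
      |1 - ((T j : ℝ) - 1 - j) * w j| * δ j := by
    intro j hj
    refine (le_abs_self _).trans ?_
    rw [abs_mul]
    exact mul_le_mul_of_nonneg_left (abs_le.2 ⟨by linarith [hl₀ j hj],
      by linarith [metric j (Finset.mem_range.1 hj) l₀ hl₀k]⟩) (abs_nonneg _)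
  have hcol : ∀ l ∈ Finset.range k, (∑ j ∈ Finset.range l with l < T j, w j) * δ l +
      |1 - ((T l : ℝ) - 1 - l) * w l| * δ l ≤ c * δ l := by
    intro l hl
    rw [← add_mul]
    exact mul_le_mul_of_nonneg_right (hd l (Finset.mem_range.1 hl))
      (δ_nonneg l (Finset.mem_range.1 hl))
  have h1 := Finset.sum_le_sum hrow
  have h2 := Finset.sum_le_sum hdev
  have h3 := Finset.sum_le_sum hcol
  rw [Finset.sum_add_distrib, hswap, ← Finset.sum_mul] at h1
  rw [Finset.sum_add_distrib, ← Finset.mul_sum] at h3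
  have h4 : ∑ j ∈ Finset.range k, a j = ∑ j ∈ Finset.range k, ((T j : ℝ) - 1 - j) * w j * a j +
      ∑ j ∈ Finset.range k, (1 - ((T j : ℝ) - 1 - j) * w j) * (a j - s) +
      (k - ∑ j ∈ Finset.range k, ((T j : ℝ) - 1 - j) * w j) * s := by
    have h5 : (k : ℝ) = ∑ j ∈ Finset.range k, (1 : ℝ) := by simp
    rw [h5, ← Finset.sum_sub_distrib, Finset.sum_mul, ← Finset.sum_add_distrib,
      ← Finset.sum_add_distrib]
    exact Finset.sum_congr rfl fun j _ => by ring
  have h5 := mul_le_mul_of_nonneg_right hf f_nonneg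
  have h6 := mul_nonneg (sub_nonneg.2 hs) hs0
  linarith

theorem le_of_mem_upperValues_of_dual {k : ℕ} {w : ℕ → ℝ} {T : ℕ → ℕ} {c : ℝ}
    (w_nonneg : ∀ j, 0 ≤ w j) (hT : ∀ j < k, j < T j ∧ T j ≤ k)
    (hf : ∑ j ∈ Finset.range k, w j ≤ c)
    (hd : ∀ l < k, ∑ j ∈ Finset.range l with l < T j, w j + |1 - ((T l : ℝ) - 1 - l) * w l| ≤ c)
    (hs : (k : ℝ) ≤ ∑ j ∈ Finset.range k, ((T j : ℝ) - 1 - j) * w j)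
    {v : ℝ} (hv : v ∈ upperValues k) : v ≤ c := by
  obtain ⟨α, d, f, h, rfl⟩ := mem_upperValues_iff.1 hv
  have hc : 0 ≤ c := (Finset.sum_nonneg fun j _ => w_nonneg j).trans hf
  set a : ℕ → ℝ := fun j => if hj : j < k then α ⟨j, hj⟩ else 0 with ha
  set δ : ℕ → ℝ := fun j => if hj : j < k then d ⟨j, hj⟩ else 0 with hδ
  have hak : ∀ j (hj : j < k), a j = α ⟨j, hj⟩ := fun j hj => dif_pos hj
  have hδk : ∀ j (hj : j < k), δ j = d ⟨j, hj⟩ := fun j hj => dif_pos hj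
  have key := sum_range_le_mul_of_dual w_nonneg hT hf hd hs (a := a) (δ := δ) (f := f)
    (fun j hj l hl => by rw [hak j hj, hak l hl, hδk j hj, hδk l hl]; exact h.metric _ _)
    (fun j hj => by
      refine le_of_eq_of_le ?_ (h.contribution ⟨j, hj⟩)
      rw [show Finset.Ico (j + 1) k = (Finset.Ioi (⟨j, hj⟩ : Fin k)).map Fin.valEmbedding by
        rw [Fin.map_valEmbedding_Ioi]; rfl, Finset.sum_map]
      exact Finset.sum_congr rfl fun l _ => by
        rw [hak j hj, Fin.valEmbedding_apply, hδk l l.2])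
    (fun j hj => by rw [hak j hj]; exact h.α_nonneg _)
    (fun j hj => by rw [hδk j hj]; exact h.d_nonneg _) h.f_nonneg
  rw [← Fin.sum_univ_eq_sum_range, ← Fin.sum_univ_eq_sum_range] at key
  simp only [hak _ (Fin.is_lt _), hδk _ (Fin.is_lt _)] at key
  exact key.trans (mul_le_of_le_one_right hc h.budget)

/-! ### A dual solution of the upper program of size 1000 -/

/-- Cumulative dual weights: the sum of the weights of the cities before `j`, in units of `10⁻⁹`.
The weights are those of a near-optimal dual solution in which the constraints on the cities are
tight: this makes them constant on each of the blocks before `373`, and proportional to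
`1 / ((1000 - j) * (999 - j))` on each of the blocks from `373` to `720`. -/
def dualCumulative (j : ℕ) : ℕ :=
  if j ≤ 62 then 4178000 * j
  else if j ≤ 124 then 259036000 + 4097600 * (j - 62)
  else if j ≤ 186 then 513087200 + 3998000 * (j - 124)
  else if j ≤ 248 then 760963200 + 3855000 * (j - 186)
  else if j ≤ 373 then 999973200 + 2416200 * (j - 248)
  else if j ≤ 675 then 815969492 + 304740000000 / (1000 - j)
  else if j ≤ 687 then 1075015646 + 220550000000 / (1000 - j)
  else if j ≤ 701 then 1329041205 + 141040000000 / (1000 - j)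
  else if j ≤ 720 then 1576934181 + 66920000000 / (1000 - j)
  else 1815934181

/-- The first city left out of the contribution constraint of the city `j`.  In an optimal primal
solution it is the first `l > j` with `d l > α j`; a step function with four jumps is a good enough
approximation. -/
def dualThreshold (j : ℕ) : ℕ :=
  if j < 62 then 675 else if j < 124 then 687 else if j < 186 then 701 else if j < 248 then 720
  else 1000

/-- No city before `dualStart l` has `l` in its restricted contribution constraint. -/
def dualStart (l : ℕ) : ℕ :=
  if l < 675 then 0 else if l < 687 then 62 else if l < 701 then 124 else if l < 720 then 186
  else 248

/-- The weight of the contribution constraint of the city `j`, in units of `10⁻⁹`. -/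
def dualWeight (j : ℕ) : ℕ := dualCumulative (j + 1) - dualCumulative j

theorem dualCumulative_le_succ : ∀ l < 1000, dualCumulative l ≤ dualCumulative (l + 1) := by
  decide +kernel

/-- The dual constraints of the cities, with objective value `1.81599`; the two inequalities are the
two signs of the absolute value in `le_of_mem_upperValues_of_dual`. -/
theorem dual_constraint : ∀ l < 1000,
    dualCumulative l - dualCumulative (dualStart l) + 10 ^ 9 ≤
      1815990000 + (dualThreshold l - 1 - l) * dualWeight l ∧
    dualCumulative l - dualCumulative (dualStart l) + (dualThreshold l - 1 - l) * dualWeight l ≤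
      1815990000 + 10 ^ 9 := by
  decide +kernel

theorem dual_total :
    1000 * 10 ^ 9 ≤ ∑ l ∈ Finset.range 1000, (dualThreshold l - 1 - l) * dualWeight l := by
  decide +kernel

theorem lt_dualThreshold : ∀ j < 1000, j < dualThreshold j ∧ dualThreshold j ≤ 1000 := by
  intro j hj
  unfold dualThreshold
  split_ifs <;> omega

theorem dualStart_le {j l : ℕ} (h : l < dualThreshold j) : dualStart l ≤ j := by
  unfold dualThreshold at h
  unfold dualStart
  split_ifs at h ⊢ <;> omega

theorem dualStart_le_self (l : ℕ) : dualStart l ≤ l := by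
  unfold dualStart
  split_ifs <;> omega

theorem sum_dualWeight_Ico {m n : ℕ} (hmn : m ≤ n) (hn : n ≤ 1000) :
    ∑ j ∈ Finset.Ico m n, (dualWeight j : ℝ) = dualCumulative n - dualCumulative m := by
  rw [← Finset.sum_Ico_sub (fun j => (dualCumulative j : ℝ)) hmn]
  refine Finset.sum_congr rfl fun j hj => ?_
  have := Finset.mem_Ico.1 hj
  rw [dualWeight, Nat.cast_sub (dualCumulative_le_succ j (by omega))]

theorem dualCumulative_mono {m n : ℕ} (hmn : m ≤ n) (hn : n ≤ 1000) :
    dualCumulative m ≤ dualCumulative n := by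
  have := sum_dualWeight_Ico hmn hn
  have h : (0 : ℝ) ≤ ∑ j ∈ Finset.Ico m n, (dualWeight j : ℝ) :=
    Finset.sum_nonneg fun _ _ => Nat.cast_nonneg _
  exact_mod_cast (by linarith : (dualCumulative m : ℝ) ≤ dualCumulative n)

theorem cast_dualThreshold_sub {j : ℕ} (hj : j < 1000) :
    ((dualThreshold j - 1 - j : ℕ) : ℝ) = (dualThreshold j : ℝ) - 1 - j := by
  have := (lt_dualThreshold j hj).1
  rw [Nat.cast_sub (by omega), Nat.cast_sub (by omega), Nat.cast_one]

theorem le_of_mem_upperValues_thousand {v : ℝ} (hv : v ∈ upperValues 1000) : v ≤ 1.81599 := by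
  refine le_of_mem_upperValues_of_dual (w := fun j => dualWeight j / 10 ^ 9) (T := dualThreshold)
    (fun j => by positivity) lt_dualThreshold ?_ (fun l hl => ?_) ?_ hv
  · rw [← Finset.sum_div, Finset.range_eq_Ico, sum_dualWeight_Ico (by norm_num) le_rfl]
    norm_num [dualCumulative]
  · obtain ⟨h1, h2⟩ := dual_constraint l hl
    have h3 : ∑ j ∈ Finset.range l with l < dualThreshold j, (dualWeight j : ℝ) / 10 ^ 9 ≤
        ((dualCumulative l - dualCumulative (dualStart l) : ℕ) : ℝ) / 10 ^ 9 := by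
      rw [← Finset.sum_div, Nat.cast_sub (dualCumulative_mono (dualStart_le_self l) hl.le),
        ← sum_dualWeight_Ico (dualStart_le_self l) hl.le]
      refine div_le_div_of_nonneg_right ?_ (by positivity)
      refine Finset.sum_le_sum_of_subset_of_nonneg (fun j hj => ?_) fun _ _ _ => Nat.cast_nonneg _
      obtain ⟨hj1, hj2⟩ := Finset.mem_filter.1 hj
      exact Finset.mem_Ico.2 ⟨dualStart_le hj2, Finset.mem_range.1 hj1⟩
    have h4 : ((dualCumulative l - dualCumulative (dualStart l) : ℕ) : ℝ) + 10 ^ 9 ≤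
        1815990000 + ((dualThreshold l : ℝ) - 1 - l) * dualWeight l := by
      rw [← cast_dualThreshold_sub hl]
      exact_mod_cast h1
    have h5 : ((dualCumulative l - dualCumulative (dualStart l) : ℕ) : ℝ) +
        ((dualThreshold l : ℝ) - 1 - l) * dualWeight l ≤ 1815990000 + 10 ^ 9 := by
      rw [← cast_dualThreshold_sub hl]
      exact_mod_cast h2
    have h6 : |1 - ((dualThreshold l : ℝ) - 1 - l) * (dualWeight l / 10 ^ 9)| ≤
        1.81599 - ((dualCumulative l - dualCumulative (dualStart l) : ℕ) : ℝ) / 10 ^ 9 := by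
      rw [mul_div_assoc', abs_le]
      constructor <;> linarith
    linarith
  · have h : ((1000 * 10 ^ 9 : ℕ) : ℝ) ≤ _ := Nat.cast_le.2 dual_total
    rw [Nat.cast_sum, Finset.sum_congr rfl fun l hl => by
      rw [Nat.cast_mul, cast_dualThreshold_sub (Finset.mem_range.1 hl)]] at h
    simp_rw [mul_div_assoc']
    rw [← Finset.sum_div, le_div_iff₀ (by positivity)]
    exact_mod_cast h

/-! ### Lists of budgets as solutions of the lower program -/

/-- The sum of the offers `max (a - d) 0` at time `a` of cities with final budgets `l`, where a city
with budget `b` has distance `d = |b - s|`. -/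
def offers (s a : ℕ) : List ℕ → ℕ
  | [] => 0
  | b :: l => a - Nat.dist b s + offers s a l

/-- The contribution constraints of a list of budgets, with opening cost `F`. -/
def ContributionsLE (s F : ℕ) : List ℕ → Prop
  | [] => True
  | a :: l => offers s a (a :: l) ≤ F ∧ ContributionsLE s F l

/-- The sum of the distances `|b - s|` belonging to a list of budgets. -/
def distSum (s : ℕ) (l : List ℕ) : ℕ := (l.map (Nat.dist · s)).sum

/-- A test of the contribution constraints for the budgets of an initial segment of a list, in time
linear in its length `n`.  All distances in the segment are at most `m` and all budgets at least
`m`, so that the offers of the segment add up to `n * a - D` with `D` the sum of its distances;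
`rest a` bounds the offers of the remaining cities. -/
def contributionCheck (s F m : ℕ) (rest : ℕ → ℕ) : ℕ → ℕ → List ℕ → Bool
  | _, _, [] => true
  | n, D, a :: l => Nat.ble (Nat.dist a s) m && Nat.ble m a && Nat.ble (n * a + rest a) (F + D) &&
      contributionCheck s F m rest (n - 1) (D - Nat.dist a s) l

theorem offers_append (s a : ℕ) (l l' : List ℕ) :
    offers s a (l ++ l') = offers s a l + offers s a l' := by
  induction l with
  | nil => simp [offers]
  | cons b l ih => rw [List.cons_append, offers, offers, ih, add_assoc]

theorem offers_replicate (s a b n : ℕ) :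
    offers s a (List.replicate n b) = n * (a - Nat.dist b s) := by
  induction n with
  | zero => simp [offers]
  | succ n ih => rw [List.replicate_succ, offers, ih]; ring

theorem offers_add_distSum {s a : ℕ} {l : List ℕ} (h : ∀ b ∈ l, Nat.dist b s ≤ a) :
    offers s a l + distSum s l = l.length * a := by
  induction l with
  | nil => simp [offers, distSum]
  | cons b l ih =>
    have h1 := h b List.mem_cons_self
    have h2 := ih fun b hb => h b (List.mem_cons_of_mem _ hb)
    rw [distSum] at h2 ⊢
    rw [offers, List.map_cons, List.sum_cons, List.length_cons, Nat.succ_mul]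
    omega

theorem dist_le_of_contributionCheck {s F m : ℕ} {rest : ℕ → ℕ} {l : List ℕ} :
    ∀ {n D : ℕ}, contributionCheck s F m rest n D l = true → ∀ b ∈ l, Nat.dist b s ≤ m := by
  induction l with
  | nil => simp
  | cons a l ih =>
    intro n D h
    simp only [contributionCheck, Bool.and_eq_true, Nat.ble_eq] at h
    exact List.forall_mem_cons.2 ⟨h.1.1.1, ih h.2⟩

theorem ContributionsLE.append {s F m : ℕ} {rest : ℕ → ℕ} {l l' : List ℕ}
    (h : contributionCheck s F m rest l.length (distSum s l) l = true)
    (hrest : ∀ a, offers s a l' = rest a) (h' : ContributionsLE s F l') :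
    ContributionsLE s F (l ++ l') := by
  induction l with
  | nil => exact h'
  | cons a l ih =>
    have hd := dist_le_of_contributionCheck h
    simp only [contributionCheck, Bool.and_eq_true, Nat.ble_eq] at h
    obtain ⟨⟨⟨h1, h2⟩, h3⟩, h4⟩ := h
    refine ⟨?_, ih ?_⟩
    · change offers s a ((a :: l) ++ l') ≤ F
      rw [offers_append, hrest]
      have := offers_add_distSum fun b hb => (hd b hb).trans h2
      omega
    · have h5 : distSum s (a :: l) - Nat.dist a s = distSum s l := by
        simp [distSum]
      rwa [h5, List.length_cons, Nat.add_sub_cancel] at h4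

theorem ContributionsLE.drop {s F : ℕ} {l : List ℕ} (h : ContributionsLE s F l) {j : ℕ}
    (hj : j < l.length) : offers s (l.getD j 0) (l.drop j) ≤ F := by
  induction l generalizing j with
  | nil => simp at hj
  | cons a l ih =>
    cases j with
    | zero => exact h.1
    | succ j => exact ih h.2 (by simpa using hj)

theorem sum_range_getD (g : ℕ → ℕ) (l : List ℕ) :
    ∑ j ∈ Finset.range l.length, g (l.getD j 0) = (l.map g).sum := by
  induction l with
  | nil => simp
  | cons a l ih => simp [Finset.sum_range_succ', ← ih, add_comm]

theorem offers_eq_sum (s a : ℕ) (l : List ℕ) :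
    offers s a l = (l.map fun b => a - Nat.dist b s).sum := by
  induction l with
  | nil => simp [offers]
  | cons b l ih => simp [offers, ih]

/-- A nondecreasing list of budgets satisfying the contribution constraints is, after scaling, a
feasible solution of the lower program. -/
theorem mem_lowerValues_of_list {s F : ℕ} {l : List ℕ} (hF : 0 < F) (hl : l.Pairwise (· ≤ ·))
    (h : ContributionsLE s F l) :
    (l.sum : ℝ) / (F + distSum s l : ℕ) ∈ lowerValues l.length := by
  set N : ℝ := ((F + distSum s l : ℕ) : ℝ) with hN
  have hNpos : 0 < N := by rw [hN]; exact_mod_cast (by omega : 0 < F + distSum s l)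
  have hsum : ∀ g : ℕ → ℕ, ∑ j : Fin l.length, ((g (l.getD j 0) : ℕ) : ℝ) / N =
      ((l.map g).sum : ℕ) / N := by
    intro g
    rw [← Finset.sum_div, Fin.sum_univ_eq_sum_range fun j => ((g (l.getD j 0) : ℕ) : ℝ),
      ← Nat.cast_sum, sum_range_getD]
  have habs : ∀ b : ℕ, ((Nat.dist b s : ℕ) : ℝ) = |(b : ℝ) - s| := by
    intro b
    rcases le_total b s with hb | hb
    · rw [Nat.dist_eq_sub_of_le hb, Nat.cast_sub hb, abs_sub_comm,
        abs_of_nonneg (sub_nonneg.2 (Nat.cast_le.2 hb))]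
    · rw [Nat.dist_eq_sub_of_le_right hb, Nat.cast_sub hb,
        abs_of_nonneg (sub_nonneg.2 (Nat.cast_le.2 hb))]
  refine mem_lowerValues_iff.2 ⟨fun j => (l.getD j 0 : ℕ) / N,
    fun j => (Nat.dist (l.getD j 0) s : ℕ) / N, F / N, ⟨?_, fun i j hij => ?_, fun i j => ?_,
      fun j => ?_, fun j => by positivity, fun j => by positivity, by positivity⟩, ?_⟩
  · rw [hsum fun b => Nat.dist b s, ← add_div, div_le_one hNpos, hN, Nat.cast_add]
    rfl
  · refine div_le_div_of_nonneg_right (Nat.cast_le.2 ?_) hNpos.le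
    rcases hij.eq_or_lt with rfl | hij
    · exact le_rfl
    · rw [List.getD_eq_getElem _ _ i.2, List.getD_eq_getElem _ _ j.2]
      exact List.pairwise_iff_getElem.1 hl i j i.2 j.2 hij
  · rw [← add_div, ← add_div]
    refine div_le_div_of_nonneg_right ?_ hNpos.le
    rw [habs, habs]
    linarith [le_abs_self ((l.getD i 0 : ℝ) - s), neg_abs_le ((l.getD j 0 : ℝ) - s)]
  · have h1 := h.drop j.2
    rw [offers_eq_sum, ← sum_range_getD, List.length_drop] at h1
    have h2 : ∀ l' : Fin l.length, max ((l.getD j 0 : ℕ) / N - (Nat.dist (l.getD l' 0) s : ℕ) / N) 0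
        ≤ ((l.getD j 0 - Nat.dist (l.getD l' 0) s : ℕ) : ℝ) / N := by
      intro l'
      refine max_le ?_ (by positivity)
      rw [← sub_div]
      exact div_le_div_of_nonneg_right (sub_le_iff_le_add.2 (by exact_mod_cast le_tsub_add)) hNpos.le
    refine (Finset.sum_le_sum fun l' _ => h2 l').trans ?_
    rw [← Finset.sum_div]
    refine div_le_div_of_nonneg_right ?_ hNpos.le
    have h3 : ∑ l' ∈ Finset.Ici j, ((l.getD j 0 - Nat.dist (l.getD l' 0) s : ℕ) : ℝ) =
        ∑ x ∈ Finset.range (l.length - j),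
          ((l.getD j 0 - Nat.dist ((l.drop j).getD x 0) s : ℕ) : ℝ) := by
      refine (Finset.sum_map (Finset.Ici j) Fin.valEmbedding
        fun n => ((l.getD j 0 - Nat.dist (l.getD n 0) s : ℕ) : ℝ)).symm.trans ?_
      rw [Fin.map_valEmbedding_Ici, Finset.sum_Ico_eq_sum_range]
      refine Finset.sum_congr rfl fun x _ => ?_
      congr 3
      simp [List.getD_eq_getElem?_getD, List.getElem?_drop]
    rw [h3]
    exact_mod_cast h1
  · have := hsum id
    simp only [id, List.map_id] at this
    exact this.symm

/-! ### A solution of the lower program of size 1000 -/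

/-- The first `671` budgets of a near-optimal solution of the lower program with `k = 1000`. -/
def earlyBudgets : List ℕ := [
  64491, 64534, 64578, 64621, 64665, 64709, 64753, 64798, 64842, 64887, 64932, 64977, 65022,
  65068, 65113, 65159, 65205, 65252, 65298, 65345, 65392, 65439, 65486, 65534, 65582, 65630,
  65678, 65726, 65775, 65824, 65873, 65922, 65971, 66021, 66071, 66121, 66171, 66222, 66272,
  66323, 66375, 66426, 66478, 66530, 66582, 66634, 66687, 66740, 66793, 66846, 66900, 66954,
  67008, 67062, 67116, 67171, 67226, 67282, 67337, 67393, 67449, 67505, 67562, 67619, 67676,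
  67733, 67791, 67848, 67907, 67965, 68024, 68082, 68142, 68201, 68261, 68321, 68381, 68442,
  68503, 68564, 68625, 68687, 68749, 68811, 68874, 68937, 69000, 69063, 69127, 69191, 69255,
  69320, 69385, 69450, 69516, 69582, 69648, 69714, 69781, 69848, 69916, 69984, 70052, 70120,
  70189, 70258, 70327, 70397, 70467, 70538, 70608, 70679, 70751, 70823, 70895, 70967, 71040,
  71113, 71187, 71260, 71335, 71409, 71484, 71559, 71635, 71711, 71788, 71864, 71941, 72019,
  72097, 72175, 72254, 72333, 72412, 72492, 72573, 72653, 72734, 72816, 72897, 72980, 73062,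
  73145, 73229, 73313, 73397, 73482, 73567, 73652, 73738, 73825, 73912, 73999, 74087, 74175,
  74263, 74352, 74442, 74532, 74622, 74713, 74804, 74896, 74988, 75081, 75174, 75268, 75362,
  75457, 75552, 75647, 75743, 75840, 75937, 76034, 76132, 76231, 76330, 76429, 76529, 76630,
  76731, 76833, 76935, 77037, 77140, 77244, 77348, 77453, 77559, 77664, 77771, 77878, 77985,
  78093, 78202, 78311, 78421, 78531, 78642, 78754, 78866, 78978, 79092, 79205, 79320, 79435,
  79551, 79667, 79784, 79901, 80019, 80138, 80257, 80377, 80498, 80619, 80741, 80864, 80987,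
  81111, 81235, 81360, 81486, 81613, 81740, 81868, 81996, 82125, 82255, 82386, 82517, 82649,
  82782, 82915, 83049, 83184, 83320, 83456, 83593, 83731, 83870, 84009, 84149, 84290, 84431,
  84574, 84717, 84860, 84953, 85047, 85140, 85235, 85329, 85424, 85519, 85615, 85711, 85807,
  85904, 86001, 86099, 86197, 86295, 86394, 86493, 86592, 86692, 86793, 86894, 86995, 87096,
  87199, 87301, 87404, 87507, 87611, 87715, 87820, 87925, 88030, 88136, 88243, 88349, 88457,
  88564, 88673, 88781, 88890, 89000, 89110, 89220, 89331, 89443, 89555, 89667, 89780, 89893,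
  90007, 90121, 90236, 90351, 90467, 90584, 90700, 90818, 90935, 91054, 91173, 91292, 91412,
  91532, 91653, 91774, 91896, 92019, 92142, 92266, 92390, 92514, 92640, 92765, 92892, 93019,
  93146, 93274, 93403, 93532, 93662, 93792, 93923, 94054, 94187, 94319, 94453, 94586, 94721,
  94856, 94992, 95128, 95265, 95403, 95541, 95680, 95819, 95959, 96100, 96241, 96384, 96526,
  96670, 96814, 96958, 97104, 97250, 97397, 97544, 97692, 97841, 97990, 98141, 98292, 98443,
  98596, 98749, 98902, 99057, 99212, 99368, 99525, 99682, 99841, 99999, 100159, 100319, 100480,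
  100640, 100801, 100962, 101123, 101285, 101446, 101609, 101771, 101933, 102096, 102259, 102423,
  102587, 102750, 102915, 103079, 103244, 103409, 103574, 103740, 103906, 104072, 104238, 104405,
  104572, 104739, 104906, 105074, 105242, 105411, 105579, 105748, 105917, 106087, 106257, 106427,
  106597, 106768, 106939, 107110, 107281, 107453, 107625, 107798, 107971, 108144, 108317, 108490,
  108664, 108839, 109013, 109188, 109363, 109538, 109714, 109890, 110067, 110243, 110420, 110598,
  110775, 110953, 111131, 111310, 111489, 111668, 111848, 112028, 112208, 112388, 112569, 112750,
  112932, 113113, 113296, 113478, 113661, 113844, 114028, 114211, 114396, 114580, 114765, 114950,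
  115136, 115321, 115508, 115694, 115881, 116068, 116256, 116444, 116632, 116821, 117010, 117199,
  117389, 117579, 117770, 117961, 118152, 118343, 118535, 118728, 118920, 119113, 119307, 119501,
  119695, 119889, 120084, 120280, 120475, 120671, 120868, 121065, 121262, 121460, 121658, 121856,
  122055, 122254, 122454, 122654, 122854, 123055, 123256, 123458, 123660, 123862, 124065, 124268,
  124472, 124676, 124880, 125085, 125291, 125496, 125703, 125909, 126116, 126324, 126532, 126740,
  126949, 127158, 127368, 127578, 127788, 127999, 128211, 128422, 128635, 128848, 129061, 129274,
  129489, 129703, 129918, 130134, 130350, 130566, 130783, 131000, 131218, 131437, 131655, 131875,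
  132095, 132315, 132536, 132757, 132979, 133201, 133423, 133647, 133870, 134095, 134319, 134545,
  134770, 134997, 135223, 135451, 135678, 135907, 136136, 136365, 136595, 136825, 137056, 137288,
  137520, 137752, 137985, 138219, 138453, 138688, 138923, 139159, 139395, 139632, 139870, 140108,
  140347, 140586, 140826, 141066, 141307, 141549, 141791, 142033, 142277, 142521, 142765, 143010,
  143256, 143502, 143749, 143997, 144245, 144494, 144743, 144993, 145244, 145495, 145747, 145999,
  146252, 146506, 146761, 147016, 147272, 147528, 147785, 148043, 148301, 148560, 148820, 149080,
  149341, 149603, 149866, 150129, 150393, 150657, 150923, 151189, 151455, 151723, 151991, 152259,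
  152529, 152799, 153070, 153342, 153615, 153888, 154162, 154436, 154712, 154988, 155265, 155543,
  155821, 156101, 156381, 156662, 156944, 157226, 157509, 157793, 158078, 158364, 158651, 158938,
  159226, 159515, 159805, 160096, 160387, 160680, 160973, 161267, 161562, 161858, 162155, 162452,
  162751, 163050, 163350, 163652, 163954, 164257]

/-- The next `61` budgets.  From here on distances exceed the budgets of some of the earliest
cities, so that offers may vanish. -/
def lateBudgets : List ℕ := [
  164561, 164866, 165171, 165478, 165786, 166094, 166404, 166715, 167026, 167339, 167652, 167967,
  168282, 168598, 168916, 169234, 169554, 169874, 170196, 170519, 170842, 171167, 171493, 171819,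
  172147, 172476, 172806, 173137, 173470, 173803, 174137, 174473, 174810, 175147, 175486, 175827,
  176168, 176510, 176854, 177199, 177545, 177892, 178240, 178590, 178941, 179293, 179646, 180001,
  180357, 180714, 181073, 181432, 181793, 182156, 182519, 182884, 183250, 183618, 183987, 184357,
  184729]

/-- Nondecreasing budgets of `1000` cities, in units such that `α - d ≤ 10⁵ ≤ α + d` with the
distances `d = |α - 10⁵|`.  The last `268` cities are connected simultaneously. -/
def thousandBudgets : List ℕ := earlyBudgets ++ (lateBudgets ++ List.replicate 268 184860)

theorem contributionsLE_thousandBudgets : ContributionsLE 100000 26865265 thousandBudgets := by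
  have h1 : ContributionsLE 100000 26865265 (List.replicate 268 184860) := by
    rw [← List.append_nil (List.replicate 268 184860)]
    exact ContributionsLE.append (m := 84860) (rest := fun _ => 0) (by decide +kernel)
      (fun _ => rfl) trivial
  have h2 : ContributionsLE 100000 26865265 (lateBudgets ++ List.replicate 268 184860) :=
    ContributionsLE.append (m := 84860) (rest := fun a => 268 * (a - Nat.dist 184860 100000))
      (by decide +kernel) (fun a => offers_replicate _ _ _ _) h1
  exact ContributionsLE.append (m := 64257)
    (rest := fun a => offers 100000 a lateBudgets + 268 * (a - Nat.dist 184860 100000))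
    (by decide +kernel) (fun a => by rw [offers_append, offers_replicate]) h2

theorem pairwise_thousandBudgets : thousandBudgets.Pairwise (· ≤ ·) :=
  List.isChain_iff_pairwise.1 (by decide +kernel)

theorem exists_mem_lowerValues_thousand : ∃ v ∈ lowerValues 1000, 1.814 < v := by
  have h := mem_lowerValues_of_list (by norm_num) pairwise_thousandBudgets
    contributionsLE_thousandBudgets
  have h1 : thousandBudgets.length = 1000 := by decide +kernel
  have h2 : thousandBudgets.sum = 127984993 := by decide +kernel
  have h3 : distSum 100000 thousandBudgets = 43684473 := by decide +kernel
  rw [h1, h2, h3] at h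
  exact ⟨_, h, by norm_num⟩

/-! ### The approximation factor -/

theorem mainTheorem7 :
    ∃ ρ z u : ℝ, IsA1MetricFactor ρ ∧
      IsGreatest (lowerValues 1000) z ∧ IsGreatest (upperValues 1000) u ∧
      1.814 < z ∧ z ≤ ρ ∧ ρ ≤ u ∧ u < 1.816 := by
  obtain ⟨z, hz⟩ := exists_isGreatest_lowerValues (k := 1000) (by norm_num)
  obtain ⟨u, hu⟩ := exists_isGreatest_upperValues (k := 1000) (by norm_num)
  obtain ⟨v, hv, hv1⟩ := exists_mem_lowerValues_thousand
  have hz1 : 1.814 < z := hv1.trans_le (hz.2 hv)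
  have hlb : z ∈ lowerBounds {γ | IsA1MetricApprox γ} := fun γ hγ =>
    le_of_isA1MetricApprox hz.1 (by linarith) hγ
  have hub : IsA1MetricApprox u := isA1MetricApprox_of_mem_upperBounds (by norm_num) hu.2
  exact ⟨_, z, u, isA1MetricFactor_sInf hlb ⟨u, hub⟩, hz, hu, hz1, le_csInf ⟨u, hub⟩ hlb,
    csInf_le ⟨z, hlb⟩ hub, (le_of_mem_upperValues_thousand hu.1).trans_lt (by norm_num)⟩
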